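/- Consider the four-body problem with masses $m_1=m_2=1$, $m_3=m_4=m$, $M=\sum_i m_i=2+2m$. For $x=(\lambda_0,\mu,r_{12},r_{13},r_{14},r_{23},r_{24},r_{34})\in\mathbb R^8$ let $U=\sum_{i<j}m_im_j/r_{ij}$, $I=\frac1M\sum_{i<j}m_im_jr_{ij}^2$, let $S$ be the Cayley--Menger determinant \[S=\det\begin{bmatrix}0&1&1&1&1\\1&0&r_{12}^2&r_{13}^2&r_{14}^2\\1&r_{12}^2&0&r_{23}^2&r_{24}^2\\1&r_{13}^2&r_{23}^2&0&r_{34}^2\\1&r_{14}^2&r_{24}^2&r_{34}^2&0\end{bmatrix},\] and $V=U+\lambda_0(I-1)+\mu S$. The Dziobek equations are $F(x,m)=0$, where $F=(F_1,\dots,F_8)$ consists of the partial derivatives of $V$ with respect to $\lambda_0,\mu,r_{12},\dots,r_{34}$ with denominators cleared: \[F_1=\sum_{i<j}m_im_jr_{ij}^2-M,\quad F_2=S,\quad F_{ij}=-Mm_im_j+2\lambda_0m_im_jr_{ij}^3+M\mu\, r_{ij}^2\,\frac{\partial S}{\partial r_{ij}}\quad(i<j).\] Let $DF$ and $D^2F$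 be the first and second derivatives of $F$ with respect to $x$, and $F_m$ the derivative with respect to $m$. A decimal followed by "?" denotes the closed interval of all numbers that differ from it by at most one unit in its last digit, and $0.?\times10^{-k}$ denotes $[-10^{-k},10^{-k}]$. Let $B\subset\mathbb R^8\times\mathbb R$ be the box of all $(x,m)$ with \[\begin{aligned} \lambda_0&\in 4.08429981829230230011485100912356858215517?,\\ \mu&\in 0.78045312314450202651992?,\\ r_{12}&\in 0.5737849085182166770049?,\\ r_{13},r_{14}&\in 0.58001687737574791204967?,\\ r_{23},r_{24}&\in 1.0069084529737404291463?,\\ r_{34}&\in 0.9886256052963805814736?,\\ m&\in 0.997294013195487928197522256274082374264547?. \end{aligned}\] Then there is exactly one $(x_0,m_0)\in B$ with $F(x_0,m_0)=0$ and $\det DF(x_0,m_0)=0$, and it has the following properties. 1. The kernel of $A=DF(x_0,m_0)$ is one-dimensional. 2. There are vectors $v,w\in\mathbb R^8$ with $Av=0$, $A^Tw=0$ and last coordinate $v_8=w_8=1$, with \[v\in(0.?\times10^{-10},-0.0597256736?,0.3336214658?,-0.1835545469?,-0.1835545469?,-0.4791733007?,-0.4791733007?,1),\] \[\begin{aligned}w\in(&0.?\times10^{-17},-0.23318293319421040?,0.990420115347107375?,-0.533270542375855490?,\\&-0.533270542375855490?,-0.4619301897243832226?,-0.4619301897243832226?,1),\end{aligned}\]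 and \[w^TF_m(x_0,m_0)\in 6.32247017553985546?,\qquad w^T[D^2F(x_0,m_0)(v,v)]\in -227.08976277782379?;\] in particular both numbers are nonzero. 3. $F(x,m)=0$ undergoes a fold bifurcation at $(x_0,m_0)$, in which two solutions merge and disappear as $m$ decreases through $m_0$. That is: (a) there is a smooth curve $s\mapsto(\gamma(s),m(s))$, $|s|<a$, of solutions with $\gamma(0)=x_0$, $m(0)=m_0$, $\gamma'(0)\ne0$, $m'(0)=0$, $m''(0)>0$, and every solution close enough to $(x_0,m_0)$ lies on it; (b) every neighbourhood of $x_0$ contains an open neighbourhood $U$ of $x_0$ for which there is $\delta>0$ such that $F(\cdot,m)=0$ has no solution in $U$ for $m_0-\delta<m<m_0$, only the solution $x_0$ for $m=m_0$, and exactly two solutions in $U$ for $m_0<m<m_0+\delta$. -/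

import Mathlib

namespace FourBody

/-! The unknowns are collected in a vector `x : Fin 8 → ℝ`,
`x = (λ₀, μ, r₁₂, r₁₃, r₁₄, r₂₃, r₂₄, r₃₄)`. -/

/-- The symmetric matrix of the mutual distances `r_ij` stored in `x`. -/
def dist (x : Fin 8 → ℝ) : Matrix (Fin 4) (Fin 4) ℝ :=
  !![0, x 2, x 3, x 4;
     x 2, 0, x 5, x 6;
     x 3, x 5, 0, x 7;
     x 4, x 6, x 7, 0]

/-- The Cayley-Menger determinant `S` of the mutual distances. -/
noncomputable def cayleyMenger (x : Fin 8 → ℝ) : ℝ :=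
  Matrix.det
    !![0, 1, 1, 1, 1;
       1, 0, x 2 ^ 2, x 3 ^ 2, x 4 ^ 2;
       1, x 2 ^ 2, 0, x 5 ^ 2, x 6 ^ 2;
       1, x 3 ^ 2, x 5 ^ 2, 0, x 7 ^ 2;
       1, x 4 ^ 2, x 6 ^ 2, x 7 ^ 2, 0]

/-- The partial derivative of a scalar function with respect to its `k`-th variable. -/
noncomputable def partialDeriv (f : (Fin 8 → ℝ) → ℝ) (k : Fin 8) (x : Fin 8 → ℝ) : ℝ :=
  deriv (fun t => f (Function.update x k t)) (x k)

/-- The total mass `M`. -/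
def totalMass (m : Fin 4 → ℝ) : ℝ := ∑ i, m i

/-- The Newtonian potential `U = ∑_{i<j} m_i m_j / r_ij`. -/
noncomputable def potential (m : Fin 4 → ℝ) (x : Fin 8 → ℝ) : ℝ :=
  ∑ i, ∑ j ∈ Finset.Ioi i, m i * m j / dist x i j

/-- The moment of inertia about the centre of mass, `I = (1/M) ∑_{i<j} m_i m_j r_ij²`. -/
noncomputable def inertia (m : Fin 4 → ℝ) (x : Fin 8 → ℝ) : ℝ :=
  (∑ i, ∑ j ∈ Finset.Ioi i, m i * m j * dist x i j ^ 2) / totalMass m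

/-- The Lagrangian `V = U + λ₀ (I - 1) + μ S`. -/
noncomputable def lagrangian (m : Fin 4 → ℝ) (x : Fin 8 → ℝ) : ℝ :=
  potential m x + x 0 * (inertia m x - 1) + x 1 * cayleyMenger x

/-- The denominators of the eight partial derivatives of `V`. -/
def denominators (m : Fin 4 → ℝ) (x : Fin 8 → ℝ) : Fin 8 → ℝ :=
  ![totalMass m, 1,
    totalMass m * x 2 ^ 2, totalMass m * x 3 ^ 2, totalMass m * x 4 ^ 2,
    totalMass m * x 5 ^ 2, totalMass m * x 6 ^ 2, totalMass m * x 7 ^ 2]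

/-- The equation `∂V/∂r = 0` with its denominator `M r²` cleared, where `r = x k` is a mutual
distance and `p` is the product of the two masses. -/
noncomputable def distanceEquation (m : Fin 4 → ℝ) (p : ℝ) (k : Fin 8) (x : Fin 8 → ℝ) : ℝ :=
  -(totalMass m * p) + 2 * x 0 * p * x k ^ 3
    + totalMass m * x 1 * x k ^ 2 * partialDeriv cayleyMenger k x

/-- The Dziobek equations `F = (F₁, …, F₈)`: the partial derivatives of `V` with respect to
`(λ₀, μ, r₁₂, r₁₃, r₁₄, r₂₃, r₂₄, r₃₄)`, with denominators cleared. -/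
noncomputable def dziobek (m : Fin 4 → ℝ) (x : Fin 8 → ℝ) : Fin 8 → ℝ :=
  ![(∑ i, ∑ j ∈ Finset.Ioi i, m i * m j * dist x i j ^ 2) - totalMass m,
    cayleyMenger x,
    distanceEquation m (m 0 * m 1) 2 x,
    distanceEquation m (m 0 * m 2) 3 x,
    distanceEquation m (m 0 * m 3) 4 x,
    distanceEquation m (m 1 * m 2) 5 x,
    distanceEquation m (m 1 * m 3) 6 x,
    distanceEquation m (m 2 * m 3) 7 x]

theorem differentiable_cayleyMenger : Differentiable ℝ cayleyMenger := by
  have e : ∀ i j : Fin 5, Differentiable ℝ (fun x : Fin 8 → ℝ =>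
      !![0, 1, 1, 1, 1;
         1, 0, x 2 ^ 2, x 3 ^ 2, x 4 ^ 2;
         1, x 2 ^ 2, 0, x 5 ^ 2, x 6 ^ 2;
         1, x 3 ^ 2, x 5 ^ 2, 0, x 7 ^ 2;
         1, x 4 ^ 2, x 6 ^ 2, x 7 ^ 2, 0] i j) := by
    intro i j
    fin_cases i <;> fin_cases j <;> simp <;> fun_prop
  unfold cayleyMenger
  simp only [Matrix.det_apply, Fin.prod_univ_five]
  exact Differentiable.fun_sum fun σ _ => Differentiable.const_smul
    (((((e _ _).mul (e _ _)).mul (e _ _)).mul (e _ _)).mul (e _ _)) _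

/-- The Dziobek equations are the partial derivatives of the Lagrangian times the denominators. -/
theorem dziobek_eq (m : Fin 4 → ℝ) (x : Fin 8 → ℝ) (hM : totalMass m ≠ 0)
    (hx : ∀ i j : Fin 4, i ≠ j → dist x i j ≠ 0) (k : Fin 8) :
    dziobek m x k = denominators m x k * partialDeriv (lagrangian m) k x := by
  have hI0 : Finset.Ioi (0 : Fin 4) = {1, 2, 3} := by decide
  have hI1 : Finset.Ioi (1 : Fin 4) = {2, 3} := by decide
  have hI2 : Finset.Ioi (2 : Fin 4) = {3} := by decide
  have hI3 : Finset.Ioi (3 : Fin 4) = ∅ := by decide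
  have h2 : x 2 ≠ 0 := by simpa [dist] using hx 0 1 (by decide)
  have h3 : x 3 ≠ 0 := by simpa [dist] using hx 0 2 (by decide)
  have h4 : x 4 ≠ 0 := by simpa [dist] using hx 0 3 (by decide)
  have h5 : x 5 ≠ 0 := by simpa [dist] using hx 1 2 (by decide)
  have h6 : x 6 ≠ 0 := by simpa [dist] using hx 1 3 (by decide)
  have h7 : x 7 ≠ 0 := by simpa [dist] using hx 2 3 (by decide)
  have hV : ∀ y, lagrangian m y =
      (m 0 * m 1 * (y 2)⁻¹ + m 0 * m 2 * (y 3)⁻¹ + m 0 * m 3 * (y 4)⁻¹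
        + m 1 * m 2 * (y 5)⁻¹ + m 1 * m 3 * (y 6)⁻¹ + m 2 * m 3 * (y 7)⁻¹)
      + y 0 * ((m 0 * m 1 * y 2 ^ 2 + m 0 * m 2 * y 3 ^ 2 + m 0 * m 3 * y 4 ^ 2
        + m 1 * m 2 * y 5 ^ 2 + m 1 * m 3 * y 6 ^ 2 + m 2 * m 3 * y 7 ^ 2) / totalMass m - 1)
      + y 1 * cayleyMenger y := by
    intro y
    simp [lagrangian, potential, inertia, Fin.sum_univ_four, hI0, hI1, hI2, hI3, dist]
    ring
  have hu : ∀ j, HasDerivAt (fun t => Function.update x k t j) (if j = k then 1 else 0) (x k) := by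
    intro j
    by_cases hj : j = k
    · subst hj; simpa using hasDerivAt_id' (x j)
    · simpa [Function.update_of_ne hj, hj] using hasDerivAt_const (x k) (x j)
  have hx' : Function.update x k (x k) = x := Function.update_eq_self k x
  have hS : HasDerivAt (fun t => cayleyMenger (Function.update x k t))
      (partialDeriv cayleyMenger k x) (x k) := by
    have h : DifferentiableAt ℝ (fun t => Function.update x k t) (x k) :=
      differentiableAt_pi.2 fun j => (hu j).differentiableAt
    have hd : DifferentiableAt ℝ (fun t => cayleyMenger (Function.update x k t)) (x k) :=
      DifferentiableAt.comp (g := cayleyMenger) (x k) (differentiable_cayleyMenger _) h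
    exact hd.hasDerivAt
  have hinv : ∀ j, x j ≠ 0 → HasDerivAt (fun t => (Function.update x k t j)⁻¹)
      (-(if j = k then 1 else 0) / x j ^ 2) (x k) := by
    intro j hj
    simpa [hx'] using (hu j).fun_inv (by simpa [hx'] using hj)
  have hsq : ∀ j, HasDerivAt (fun t => Function.update x k t j ^ 2)
      (2 * x j * (if j = k then 1 else 0)) (x k) := by
    intro j
    simpa [hx'] using (hu j).fun_pow 2
  have key := (((((((hinv 2 h2).const_mul (m 0 * m 1)).fun_add
    ((hinv 3 h3).const_mul (m 0 * m 2))).fun_add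
    ((hinv 4 h4).const_mul (m 0 * m 3))).fun_add
    ((hinv 5 h5).const_mul (m 1 * m 2))).fun_add
    ((hinv 6 h6).const_mul (m 1 * m 3))).fun_add
    ((hinv 7 h7).const_mul (m 2 * m 3))).fun_add
    ((hu 0).fun_mul ((((((((hsq 2).const_mul (m 0 * m 1)).fun_add
    ((hsq 3).const_mul (m 0 * m 2))).fun_add
    ((hsq 4).const_mul (m 0 * m 3))).fun_add
    ((hsq 5).const_mul (m 1 * m 2))).fun_add
    ((hsq 6).const_mul (m 1 * m 3))).fun_add
    ((hsq 7).const_mul (m 2 * m 3))).div_const (totalMass m) |>.sub_const 1)) |>.fun_add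
    ((hu 1).fun_mul hS)
  have hP := (key.congr_of_eventuallyEq
    (Filter.Eventually.of_forall fun t => hV (Function.update x k t))).deriv
  have hz : k = 0 ∨ k = 1 → partialDeriv cayleyMenger k x = 0 := by
    rintro (rfl | rfl) <;> simp [partialDeriv, cayleyMenger, Function.update]
  rw [show partialDeriv (lagrangian m) k x = deriv (fun t => lagrangian m (Function.update x k t))
    (x k) from rfl, hP, hx']
  fin_cases k <;>
    simp [dziobek, denominators, distanceEquation, Fin.sum_univ_four, hI0, hI1, hI2, hI3, dist]
      at hz ⊢ <;> (try simp [hz]) <;> field_simp <;> ring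

/-- The masses `m₁ = m₂ = 1`, `m₃ = m₄ = m`. -/
def masses (m : ℝ) : Fin 4 → ℝ := ![1, 1, m, m]

/-- The Dziobek equations for `m₁ = m₂ = 1`, `m₃ = m₄ = m`, as a one-parameter family. -/
noncomputable def F (x : Fin 8 → ℝ) (m : ℝ) : Fin 8 → ℝ := dziobek (masses m) x

/-- The Jacobian matrix `DF(x, m)` with respect to `x`. -/
noncomputable def DF (x : Fin 8 → ℝ) (m : ℝ) : Matrix (Fin 8) (Fin 8) ℝ :=
  LinearMap.toMatrix' (fderiv ℝ (fun y => F y m) x : (Fin 8 → ℝ) →ₗ[ℝ] (Fin 8 → ℝ))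

/-- The partial derivative `F_m(x, m)` with respect to the parameter. -/
noncomputable def Fm (x : Fin 8 → ℝ) (m : ℝ) : Fin 8 → ℝ := deriv (fun t => F x t) m

/-- The second derivative `D²F(x, m)(u, v)` with respect to `x`. -/
noncomputable def D2F (x : Fin 8 → ℝ) (m : ℝ) (u v : Fin 8 → ℝ) : Fin 8 → ℝ :=
  iteratedFDeriv ℝ 2 (fun y => F y m) x ![u, v]

/-- The box `[x]` enclosing the solution: every displayed decimal is correct up to one unit in its
last digit. -/
def xBox : Set (Fin 8 → ℝ) := {x |
  |x 0 - 4.08429981829230230011485100912356858215517| ≤ 10 ^ (-41 : ℤ) ∧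
  |x 1 - 0.78045312314450202651992| ≤ 10 ^ (-23 : ℤ) ∧
  |x 2 - 0.5737849085182166770049| ≤ 10 ^ (-22 : ℤ) ∧
  |x 3 - 0.58001687737574791204967| ≤ 10 ^ (-23 : ℤ) ∧
  |x 4 - 0.58001687737574791204967| ≤ 10 ^ (-23 : ℤ) ∧
  |x 5 - 1.0069084529737404291463| ≤ 10 ^ (-22 : ℤ) ∧
  |x 6 - 1.0069084529737404291463| ≤ 10 ^ (-22 : ℤ) ∧
  |x 7 - 0.9886256052963805814736| ≤ 10 ^ (-22 : ℤ)}

/-- The interval enclosing the bifurcation value of the mass. -/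
def mBox : Set ℝ := {m |
  |m - 0.997294013195487928197522256274082374264547| ≤ 10 ^ (-42 : ℤ)}

/-- The enclosure of the right null vector. -/
def vBox : Set (Fin 8 → ℝ) := {v |
  |v 0| ≤ 10 ^ (-10 : ℤ) ∧
  |v 1 + 0.0597256736| ≤ 10 ^ (-10 : ℤ) ∧
  |v 2 - 0.3336214658| ≤ 10 ^ (-10 : ℤ) ∧
  |v 3 + 0.1835545469| ≤ 10 ^ (-10 : ℤ) ∧
  |v 4 + 0.1835545469| ≤ 10 ^ (-10 : ℤ) ∧
  |v 5 + 0.4791733007| ≤ 10 ^ (-10 : ℤ) ∧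
  |v 6 + 0.4791733007| ≤ 10 ^ (-10 : ℤ) ∧
  v 7 = 1}

/-- The enclosure of the left null vector. -/
def wBox : Set (Fin 8 → ℝ) := {w |
  |w 0| ≤ 10 ^ (-17 : ℤ) ∧
  |w 1 + 0.23318293319421040| ≤ 10 ^ (-17 : ℤ) ∧
  |w 2 - 0.990420115347107375| ≤ 10 ^ (-18 : ℤ) ∧
  |w 3 + 0.533270542375855490| ≤ 10 ^ (-18 : ℤ) ∧
  |w 4 + 0.533270542375855490| ≤ 10 ^ (-18 : ℤ) ∧
  |w 5 + 0.4619301897243832226| ≤ 10 ^ (-19 : ℤ) ∧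
  |w 6 + 0.4619301897243832226| ≤ 10 ^ (-19 : ℤ) ∧
  w 7 = 1}

end FourBody

open scoped ContDiff in
/-- The equation `G(x, μ) = 0` has a fold bifurcation at `(x₀, μ₀)`, with the two solutions on the
side `μ > μ₀`: near `(x₀, μ₀)` the solutions form a smooth curve that is quadratically tangent to
`μ = μ₀`, and as `μ` decreases through `μ₀` two solutions merge at `x₀` and disappear. -/
structure IsFoldBifurcation {n : ℕ} (G : (Fin n → ℝ) → ℝ → (Fin n → ℝ)) (x₀ : Fin n → ℝ)
    (μ₀ : ℝ) : Prop where
  curve : ∃ a > 0, ∃ (γ : ℝ → Fin n → ℝ) (μ : ℝ → ℝ),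
    ContDiffOn ℝ ∞ γ (Set.Ioo (-a) a) ∧ ContDiffOn ℝ ∞ μ (Set.Ioo (-a) a) ∧
    γ 0 = x₀ ∧ μ 0 = μ₀ ∧ deriv γ 0 ≠ 0 ∧ deriv μ 0 = 0 ∧ 0 < deriv (deriv μ) 0 ∧
    (∀ s ∈ Set.Ioo (-a) a, G (γ s) (μ s) = 0) ∧
    ∀ᶠ p in nhds (x₀, μ₀), G p.1 p.2 = 0 → ∃ s ∈ Set.Ioo (-a) a, γ s = p.1 ∧ μ s = p.2
  count : ∀ W ∈ nhds x₀, ∃ U ⊆ W, IsOpen U ∧ x₀ ∈ U ∧ ∃ δ > 0,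
    (∀ μ ∈ Set.Ioo (μ₀ - δ) μ₀, {x ∈ U | G x μ = 0} = ∅) ∧
    {x ∈ U | G x μ₀ = 0} = {x₀} ∧
    ∀ μ ∈ Set.Ioo μ₀ (μ₀ + δ), {x ∈ U | G x μ = 0}.ncard = 2

/-! A singular solution of `F = 0` is turned into a regular zero. Writing `v` for a null vector with
last coordinate 1, consider the extended system `H(x, m, v) = (F(x, m), DF(x, m) v)`: 16 equations
in 16 unknowns, whose zeros are the singular solutions with a null vector normalized in this way. At
the fold `DF` is singular but `DH` is not, so a Newton-type argument applies.

With an approximate zero `z̃` and an approximate inverse `C` of `DH(z̃)`, put `N(z) = z - C H(z)`.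
Integer ball arithmetic, evaluated in the kernel, shows that `‖C DH - 1‖ ≤ 1/2` in the sup norm on
the ball of radius `10⁻⁶` about `z̃` (`defect_check`) and that `‖C H(z̃)‖ ≤ 10⁻⁴⁵`
(`residual_check`). Hence `N` contracts the ball of radius `10⁻⁴⁴` into itself, which gives a zero
of `H` (`exists_extendedMap_eq_zero`), and `H` is injective on the larger ball
(`extendedMap_injOn`).

Uniqueness in the box concerns `(x, m)` only, with no a priori control of the null vector. Since `H`
is affine in `v`, arbitrarily small multiples of a displacement of `v` carry all the information.
Thus a null vector cannot have last coordinate 0 (`eq_zero_of_DF_mulVec_eq_zero`, which also makes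
the kernel one-dimensional), and a normalized one must lie near the centre (`norm_assemble_sub_le`),
where injectivity applies.

Each Dziobek equation is a denominator `d_k` times `∂_k V`, and `d_k` involves no coordinate of `x`
except possibly the `k`-th. So `DF` is a symmetric matrix up to the denominators, and a right null
vector `v` yields the left null vector `w_k = v_k d₈ / d_k`. The numbers `w · F_m` and `w · D²F(v,
v)` are then enclosed by ball arithmetic. Their signs give the fold through a general theorem,
`isFoldBifurcation_of_nondegenerate`, based on the inverse function theorem. -/

namespace FourBody

/-! ### Sparse polynomials with integer coefficients -/

/-- A monomial, as a list of pairs `(variable, exponent)`. -/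
abbrev Mono := List (ℕ × ℕ)

/-- A polynomial, as a list of pairs `(coefficient, monomial)`. -/
abbrev Poly := List (ℤ × Mono)

/-- The value of a monomial. -/
noncomputable def monoEval (ρ : ℕ → ℝ) : Mono → ℝ
  | [] => 1
  | (i, e) :: l => ρ i ^ e * monoEval ρ l

/-- The value of a polynomial. -/
noncomputable def polyEval (ρ : ℕ → ℝ) : Poly → ℝ
  | [] => 0
  | (c, l) :: p => c * monoEval ρ l + polyEval ρ p

/-- Multiplication of a monomial by the power `X_i ^ e`. -/
def monoInsert (i e : ℕ) : Mono → Mono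
  | [] => [(i, e)]
  | (j, f) :: l => if i = j then (j, e + f) :: l else (j, f) :: monoInsert i e l

/-- The product of two monomials. -/
def monoMul : Mono → Mono → Mono
  | [], l => l
  | (i, e) :: k, l => monoInsert i e (monoMul k l)

/-- The product of a polynomial with a term `c • k`. -/
def termMul (c : ℤ) (k : Mono) (p : Poly) : Poly :=
  p.map fun t => (c * t.1, monoMul k t.2)

/-- The partial derivative of a monomial. -/
def monoDeriv (j : ℕ) : Mono → Poly
  | [] => []
  | (i, e) :: l =>
    let q := (monoDeriv j l).map fun t => (t.1, (i, e) :: t.2)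
    if i = j then ((e : ℤ), (i, e - 1) :: l) :: q else q

/-- The partial derivative of a polynomial. -/
def polyDeriv (j : ℕ) : Poly → Poly
  | [] => []
  | (c, l) :: p => (monoDeriv j l).map (fun t => (c * t.1, t.2)) ++ polyDeriv j p

@[simp] theorem polyEval_nil (ρ : ℕ → ℝ) : polyEval ρ [] = 0 := rfl

@[simp] theorem polyEval_cons (ρ : ℕ → ℝ) (c : ℤ) (l : Mono) (p : Poly) :
    polyEval ρ ((c, l) :: p) = c * monoEval ρ l + polyEval ρ p := rfl

@[simp] theorem monoEval_nil (ρ : ℕ → ℝ) : monoEval ρ [] = 1 := rfl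

@[simp] theorem monoEval_cons (ρ : ℕ → ℝ) (i e : ℕ) (l : Mono) :
    monoEval ρ ((i, e) :: l) = ρ i ^ e * monoEval ρ l := rfl

theorem polyEval_append (ρ : ℕ → ℝ) (p q : Poly) :
    polyEval ρ (p ++ q) = polyEval ρ p + polyEval ρ q := by
  induction p with
  | nil => simp
  | cons t p ih => obtain ⟨c, l⟩ := t; simp [ih, add_assoc]

theorem monoEval_insert (ρ : ℕ → ℝ) (i e : ℕ) (l : Mono) :
    monoEval ρ (monoInsert i e l) = ρ i ^ e * monoEval ρ l := by
  induction l with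
  | nil => simp [monoInsert]
  | cons t l ih =>
    obtain ⟨j, f⟩ := t
    by_cases h : i = j
    · subst h; simp [monoInsert, pow_add, mul_assoc]
    · simp only [monoInsert, h, if_false, monoEval_cons, ih]; ring

theorem monoEval_mul (ρ : ℕ → ℝ) (k l : Mono) :
    monoEval ρ (monoMul k l) = monoEval ρ k * monoEval ρ l := by
  induction k with
  | nil => simp [monoMul]
  | cons t k ih =>
    obtain ⟨i, e⟩ := t
    simp [monoMul, monoEval_insert, ih, mul_assoc]

theorem polyEval_termMul (ρ : ℕ → ℝ) (c : ℤ) (k : Mono) (p : Poly) :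
    polyEval ρ (termMul c k p) = c * monoEval ρ k * polyEval ρ p := by
  induction p with
  | nil => simp [termMul]
  | cons t p ih =>
    obtain ⟨d, l⟩ := t
    simp only [termMul, List.map_cons, polyEval_cons, monoEval_mul] at ih ⊢
    rw [ih]; push_cast; ring

theorem polyEval_map_cons (ρ : ℕ → ℝ) (i e : ℕ) (p : Poly) :
    polyEval ρ (p.map fun t => (t.1, (i, e) :: t.2)) = ρ i ^ e * polyEval ρ p := by
  induction p with
  | nil => simp
  | cons t p ih =>
    obtain ⟨d, l⟩ := t
    simp only [List.map_cons, polyEval_cons, monoEval_cons, ih]; ring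

theorem polyEval_map_mul (ρ : ℕ → ℝ) (c : ℤ) (p : Poly) :
    polyEval ρ (p.map fun t => (c * t.1, t.2)) = c * polyEval ρ p := by
  induction p with
  | nil => simp
  | cons t p ih =>
    obtain ⟨d, l⟩ := t
    simp only [List.map_cons, polyEval_cons, ih]; push_cast; ring

theorem polyEval_polyDeriv_cons (ρ : ℕ → ℝ) (j : ℕ) (c : ℤ) (l : Mono) (p : Poly) :
    polyEval ρ (polyDeriv j ((c, l) :: p)) =
      c * polyEval ρ (monoDeriv j l) + polyEval ρ (polyDeriv j p) := by
  simp [polyDeriv, polyEval_append, polyEval_map_mul]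

/-- Product rule along the list. A variable may occur several times in a monomial, so the tail is
differentiated even when the head matches. The truncated `e - 1` at `e = 0` is harmless because of
the coefficient `e`. -/
theorem polyEval_monoDeriv_cons (ρ : ℕ → ℝ) (j i e : ℕ) (l : Mono) :
    polyEval ρ (monoDeriv j ((i, e) :: l)) =
      (if i = j then (e : ℝ) * ρ i ^ (e - 1) * monoEval ρ l else 0)
        + ρ i ^ e * polyEval ρ (monoDeriv j l) := by
  by_cases h : i = j <;> simp [monoDeriv, h, polyEval_map_cons, mul_assoc]

section Calculus

variable {E : Type*} [NormedAddCommGroup E] [NormedSpace ℝ E]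

theorem hasFDerivAt_monoEval {n : ℕ} {ρ : E → ℕ → ℝ} {ρ' : ℕ → E →L[ℝ] ℝ} {x : E}
    (h : ∀ i, HasFDerivAt (fun y => ρ y i) (ρ' i) x) (h0 : ∀ i, n ≤ i → ρ' i = 0) (l : Mono) :
    HasFDerivAt (fun y => monoEval (ρ y) l)
      (∑ j ∈ Finset.range n, polyEval (ρ x) (monoDeriv j l) • ρ' j) x := by
  induction l with
  | nil => simpa [monoDeriv] using hasFDerivAt_const (1 : ℝ) x
  | cons t l ih =>
    obtain ⟨i, e⟩ := t
    refine (((h i).pow e).fun_mul ih).congr_fderiv ?_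
    simp only [polyEval_monoDeriv_cons, add_smul, Finset.sum_add_distrib, ite_smul, zero_smul,
      Finset.sum_ite_eq, Finset.mem_range, Finset.smul_sum, mul_smul]
    by_cases hi : i < n
    · simp only [hi, if_true, smul_smul]
      rw [add_comm]; congr 2; simp; ring
    · simp [hi, h0 i (not_lt.1 hi)]

/-- Only the first `n` variables move with `y`, the others being parameters; this keeps the sum
finite. The same chain rule then serves for the derivative in `x` (`n = 8`), in the mass (`n = 9`)
and in all unknowns of the extended system (`n = 16`). -/
theorem hasFDerivAt_polyEval {n : ℕ} {ρ : E → ℕ → ℝ} {ρ' : ℕ → E →L[ℝ] ℝ} {x : E}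
    (h : ∀ i, HasFDerivAt (fun y => ρ y i) (ρ' i) x) (h0 : ∀ i, n ≤ i → ρ' i = 0) (p : Poly) :
    HasFDerivAt (fun y => polyEval (ρ y) p)
      (∑ j ∈ Finset.range n, polyEval (ρ x) (polyDeriv j p) • ρ' j) x := by
  induction p with
  | nil => simpa [polyDeriv] using hasFDerivAt_const (0 : ℝ) x
  | cons t p ih =>
    obtain ⟨c, l⟩ := t
    refine (((hasFDerivAt_monoEval h h0 l).const_mul (c : ℝ)).fun_add ih).congr_fderiv ?_
    simp only [polyEval_polyDeriv_cons, add_smul, Finset.sum_add_distrib, Finset.smul_sum, mul_smul]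

theorem contDiff_polyEval {N : WithTop ℕ∞} {ρ : E → ℕ → ℝ} (h : ∀ i, ContDiff ℝ N fun y => ρ y i)
    (p : Poly) : ContDiff ℝ N fun y => polyEval (ρ y) p := by
  have hm : ∀ l : Mono, ContDiff ℝ N fun y => monoEval (ρ y) l := by
    intro l
    induction l with
    | nil => exact contDiff_const
    | cons t l ih => exact ((h t.1).pow t.2).mul ih
  induction p with
  | nil => exact contDiff_const
  | cons t p ih => exact (contDiff_const.mul (hm t.2)).add ih

end Calculus

/-! ### Fixed-point ball arithmetic -/

/-- The ball `(c, r)` with scale `s` contains the real number `x` if `|s x - c| ≤ r`. -/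
def InBall (s : ℕ) (b : ℤ × ℕ) (x : ℝ) : Prop := |x * s - b.1| ≤ b.2

/-- The sum of two balls. -/
def ballAdd (a b : ℤ × ℕ) : ℤ × ℕ := (a.1 + b.1, a.2 + b.2)

/-- The product of a ball with an integer. -/
def ballSmul (c : ℤ) (b : ℤ × ℕ) : ℤ × ℕ := (c * b.1, c.natAbs * b.2)

/-- The product of two balls, rounded outwards. -/
def ballMul (s : ℕ) (a b : ℤ × ℕ) : ℤ × ℕ :=
  (a.1 * b.1 / s, (a.1.natAbs * b.2 + b.1.natAbs * a.2 + a.2 * b.2) / s + 2)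

/-- The product of a ball with the `e`-th power of another one. -/
def ballPowMul (s : ℕ) (a : ℤ × ℕ) : ℕ → ℤ × ℕ → ℤ × ℕ
  | 0, b => b
  | e + 1, b => ballMul s a (ballPowMul s a e b)

/-- The enclosure of a monomial. -/
def ballMono (s : ℕ) (β : List (ℤ × ℕ)) : Mono → ℤ × ℕ
  | [] => (s, 0)
  | (i, e) :: l => ballPowMul s (β.getD i (0, 0)) e (ballMono s β l)

/-- The enclosure of a polynomial. -/
def ballPoly (s : ℕ) (β : List (ℤ × ℕ)) : Poly → ℤ × ℕ
  | [] => (0, 0)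
  | (c, l) :: p => ballAdd (ballSmul c (ballMono s β l)) (ballPoly s β p)

theorem InBall.add {s : ℕ} {a b : ℤ × ℕ} {x y : ℝ} (hx : InBall s a x) (hy : InBall s b y) :
    InBall s (ballAdd a b) (x + y) := by
  have h : (x + y) * s - ((a.1 + b.1 : ℤ) : ℝ) = (x * s - a.1) + (y * s - b.1) := by
    push_cast; ring
  simp only [InBall, ballAdd] at *
  rw [h]; push_cast
  exact (abs_add_le _ _).trans (add_le_add hx hy)

theorem InBall.smul {s : ℕ} {b : ℤ × ℕ} {x : ℝ} (c : ℤ) (hx : InBall s b x) :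
    InBall s (ballSmul c b) (c * x) := by
  have h : c * x * s - ((c * b.1 : ℤ) : ℝ) = c * (x * s - b.1) := by push_cast; ring
  simp only [InBall, ballSmul] at *
  rw [h, abs_mul]; push_cast [Nat.cast_natAbs]
  gcongr

/-- With `X = x s` and `Y = y s`, the identity `XY - cd = c(Y - d) + d(X - c) + (X - c)(Y - d)`
bounds the error by `R` before division by `s`. Rounding down the centre and rounding down the
radius each lose at most one unit, whence the `+ 2` in `ballMul`. -/
theorem InBall.mul {s : ℕ} (hs : 0 < s) {a b : ℤ × ℕ} {x y : ℝ} (hx : InBall s a x)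
    (hy : InBall s b y) : InBall s (ballMul s a b) (x * y) := by
  obtain ⟨c, r⟩ := a
  obtain ⟨d, t⟩ := b
  simp only [InBall, ballMul] at *
  have hs' : (0 : ℝ) < s := by exact_mod_cast hs
  set R : ℕ := c.natAbs * t + d.natAbs * r + r * t with hR
  have h1 : |x * s * (y * s) - c * d| ≤ R := by
    have e : x * s * (y * s) - c * d =
        c * (y * s - d) + d * (x * s - c) + (x * s - c) * (y * s - d) := by ring
    rw [e, hR]; push_cast [Nat.cast_natAbs]
    refine (abs_add_le _ _).trans (add_le_add ((abs_add_le _ _).trans (add_le_add ?_ ?_)) ?_) <;>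
      rw [abs_mul] <;> gcongr
  have h2 : ((c * d : ℤ) : ℝ) = s * ((c * d / s : ℤ) : ℝ) + ((c * d % s : ℤ) : ℝ) := by
    exact_mod_cast (Int.mul_ediv_add_emod (c * d) s).symm
  have h3 : (0 : ℝ) ≤ ((c * d % s : ℤ) : ℝ) := by
    exact_mod_cast Int.emod_nonneg _ (by omega)
  have h4 : ((c * d % s : ℤ) : ℝ) ≤ s := by
    exact_mod_cast (Int.emod_lt_of_pos (c * d) (by exact_mod_cast hs)).le
  have h5 : (R : ℝ) = s * ((R / s : ℕ) : ℝ) + ((R % s : ℕ) : ℝ) := by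
    exact_mod_cast (Nat.div_add_mod R s).symm
  have h6 : ((R % s : ℕ) : ℝ) ≤ s := by exact_mod_cast (Nat.mod_lt R hs).le
  push_cast at h2
  rw [abs_le] at h1 ⊢
  push_cast
  constructor
  · refine le_of_mul_le_mul_left ?_ hs'
    nlinarith [h1.1]
  · refine le_of_mul_le_mul_left ?_ hs'
    nlinarith [h1.2]

theorem InBall.powMul {s : ℕ} (hs : 0 < s) {a b : ℤ × ℕ} {x y : ℝ} (hx : InBall s a x)
    (hy : InBall s b y) (e : ℕ) : InBall s (ballPowMul s a e b) (x ^ e * y) := by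
  induction e with
  | zero => simpa [ballPowMul] using hy
  | succ e ih => simpa [ballPowMul, pow_succ', mul_assoc] using hx.mul hs ih

theorem inBall_ballMono {s : ℕ} (hs : 0 < s) {β : List (ℤ × ℕ)} {ρ : ℕ → ℝ}
    (h : ∀ i, InBall s (β.getD i (0, 0)) (ρ i)) (l : Mono) :
    InBall s (ballMono s β l) (monoEval ρ l) := by
  induction l with
  | nil => simp [InBall, ballMono]
  | cons t l ih => exact (h t.1).powMul hs ih t.2

theorem inBall_ballPoly {s : ℕ} (hs : 0 < s) {β : List (ℤ × ℕ)} {ρ : ℕ → ℝ}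
    (h : ∀ i, InBall s (β.getD i (0, 0)) (ρ i)) (p : Poly) :
    InBall s (ballPoly s β p) (polyEval ρ p) := by
  induction p with
  | nil => simp [InBall, ballPoly]
  | cons t p ih => exact ((inBall_ballMono hs h t.2).smul t.1).add ih

/-- The largest absolute value of the points of a ball, times the scale. -/
def ballBound (b : ℤ × ℕ) : ℕ := b.1.natAbs + b.2

theorem InBall.abs_mul_le {s : ℕ} {b : ℤ × ℕ} {x : ℝ} (h : InBall s b x) :
    |x| * s ≤ ballBound b := by
  have h1 : |x * s| ≤ |x * s - b.1| + |(b.1 : ℝ)| := by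
    simpa using abs_add_le (x * s - b.1) (b.1 : ℝ)
  simp only [InBall, ballBound] at *
  rw [abs_mul, Nat.abs_cast] at h1
  push_cast [Nat.cast_natAbs]
  linarith

/-! ### The Dziobek equations and the extended system as polynomials -/

/-- The Cayley-Menger determinant as a polynomial in the distances `X_2, …, X_7`. -/
def cayleyMengerPoly : Poly :=
  [(-2, [(5, 2), (6, 2), (7, 2)]), (-2, [(2, 2), (7, 4)]), (2, [(2, 2), (5, 2), (7, 2)]),
   (2, [(2, 2), (6, 2), (7, 2)]), (2, [(3, 2), (6, 2), (7, 2)]), (-2, [(3, 2), (6, 4)]),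
   (2, [(3, 2), (5, 2), (6, 2)]), (2, [(4, 2), (5, 2), (7, 2)]), (2, [(4, 2), (5, 2), (6, 2)]),
   (-2, [(4, 2), (5, 4)]), (-2, [(3, 2), (4, 2), (7, 2)]), (2, [(2, 2), (3, 2), (7, 2)]),
   (2, [(3, 2), (4, 2), (6, 2)]), (-2, [(3, 4), (6, 2)]), (2, [(2, 2), (4, 2), (7, 2)]),
   (-2, [(4, 4), (5, 2)]), (2, [(3, 2), (4, 2), (5, 2)]), (-2, [(2, 4), (7, 2)]),
   (-2, [(2, 2), (4, 2), (6, 2)]), (2, [(2, 2), (3, 2), (6, 2)]), (2, [(2, 2), (4, 2), (5, 2)]),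
   (-2, [(2, 2), (3, 2), (5, 2)])]

/-- The polynomial of the equation `∂V/∂r_k = 0`, where `q` is the product of the two masses. -/
def distancePoly (q : Mono) (k : ℕ) : Poly :=
  [(-2, q), (-2, monoMul [(8, 1)] q), (2, monoMul [(0, 1), (k, 3)] q)]
    ++ termMul 2 [(1, 1), (k, 2)] (polyDeriv k cayleyMengerPoly)
    ++ termMul 2 [(8, 1), (1, 1), (k, 2)] (polyDeriv k cayleyMengerPoly)

/-- The polynomials of the Dziobek equations; the variables `X_0, …, X_7` are the coordinates of
`x`, and `X_8` is the mass `m`. -/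
def dziobekPoly : ℕ → Poly
  | 0 => [(1, [(2, 2)]), (1, [(8, 1), (3, 2)]), (1, [(8, 1), (4, 2)]), (1, [(8, 1), (5, 2)]),
      (1, [(8, 1), (6, 2)]), (1, [(8, 2), (7, 2)]), (-2, []), (-2, [(8, 1)])]
  | 1 => cayleyMengerPoly
  | 2 => distancePoly [] 2
  | 3 => distancePoly [(8, 1)] 3
  | 4 => distancePoly [(8, 1)] 4
  | 5 => distancePoly [(8, 1)] 5
  | 6 => distancePoly [(8, 1)] 6
  | 7 => distancePoly [(8, 2)] 7
  | _ => []

/-- The sum of the polynomials `f 0, …, f (n - 1)`. -/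
def polySum (f : ℕ → Poly) : ℕ → Poly
  | 0 => []
  | n + 1 => polySum f n ++ f n

/-- The polynomial of the `k`-th component of `DF v`, where `v = (X_9, …, X_15, 1)`. -/
def tangentPoly (k : ℕ) : Poly :=
  polySum (fun j => termMul 1 [(9 + j, 1)] (polyDeriv j (dziobekPoly k))) 7
    ++ polyDeriv 7 (dziobekPoly k)

/-- The extended system `F(x, m) = 0`, `DF(x, m) v = 0` in the unknowns `(x, m, v)`, where
`v₈ = 1`. -/
def extendedPoly (k : ℕ) : Poly := if k < 8 then dziobekPoly k else tangentPoly (k - 8)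

/-! ### Numerical data and integer certificates checked by the kernel -/

/-- The scale of the fixed-point computations. -/
def scale : ℕ := 10 ^ 56

/-- An approximate zero of the extended system, times the scale. -/
def center : List ℤ :=
  [408429981829230230011485100912356858215516742941739213702,
   78045312314450202651991947786689266081923390102615614027,
   57378490851821667700482810448622535295916153196939043467,
   58001687737574791204967216655390255898292808959540568414,
   58001687737574791204967216655390255898292808959540568414,
   100690845297374042914624848626748194453340930170265918685,
   100690845297374042914624848626748194453340930170265918685,
   98862560529638058147354564416227020519858942041551304183,
   99729401319548792819752225627408237426454658293850925694,
   0,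
   -5972567355134543330014961401752166771866439516362114732,
   33362146580882934814675342221322980014536717916129832430,
   -18355454686912279916889797554909871198264693446982722707,
   -18355454686912279916889797554909871198264693446982722707,
   -47917330069661720525789362207864593570141524161867743119,
   -47917330069661720525789362207864593570141524161867743119]

/-- The first seven coordinates of an approximate left null vector, times the scale. -/
def leftCenter : List ℤ :=
  [0,
   -23318293319421040096279816425178789748772145036283350503,
   99042011534710737518229286046515916411354852655780152150,
   -53327054237585548932241789580286086014256880072503829503,
   -53327054237585548932241789580286086014256880072503829503,
   -46193018972438322258538533968908859371985574917046283412,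
   -46193018972438322258538533968908859371985574917046283412]

/-- An approximate inverse of the Jacobian matrix of the extended system, times `10 ^ 5`. -/
def approxInverse : List (List ℤ) :=
  [[-153369, -291897, 101405, -21274, -21274, -24690, -24690, 93022, 0, 0, 0, 0, 0, 0, 0, 0],
   [-68382, -27238, 46659, -12606, -12606, -19489, -19489, 37095, 0, -6, 26, -14, -14, -12, -12, 26],
   [7182, 8968, -540, -30, -30, 2172, 2172, -3753, 0, 34, -146, 78, 78, 68, 68, -147],
   [7260, 12880, -4250, 186, 4756, 5919, -3904, -2702, 0, -19, 80, -43, -43, -37, -37, 81],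
   [7260, 12880, -4250, 4756, 186, -3904, 5919, -2702, 0, -19, 80, -43, -43, -37, -37, 81],
   [12603, -1120, -4172, 17756, -11848, -8538, 13898, -7104, 0, -49, 209, -113, -113, -97, -97, 211],
   [12603, -1120, -4172, -11848, 17756, 13898, -8538, -7104, 0, -49, 209, -113, -113, -97, -97, 211],
   [12375, -13130, -7273, 2442, 2442, 1919, 1919, -1434, 0, 103, -436, 235, 235, 203, 203, -440],
   [0, -3688, 15665, -8435, -8435, -7306, -7306, 15817, 0, 0, 0, 0, 0, 0, 0, 0],
   [0, 17918, 0, 0, 0, 0, 0, 0, -153369, -273159, 21815, 21580, 21580, 12431, 12431, 12661],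
   [5981, -38838, 15011, -15636, -15636, -11724, -11724, 38272, -67643, -18576, 6101, 9144, 9144, -661, -661, -3502],
   [0, -12929, 4332, -6291, -6291, -689, -689, 9643, 3054, 13016, 3302, -1607, -1607, 872, 872, -1845],
   [0, -5395, -3946, -187591, 192404, 183664, -179319, -5216, 9531, 9694, -2288, -1141, 3429, 4734, -5089, 363],
   [0, -5395, -3946, 192404, -187591, -179319, 183664, -5216, 9531, 9694, -2288, 3429, -1141, -5089, 4734, 363],
   [0, 15087, -4226, 546638, -537843, -515735, 519698, -8543, 18533, -9386, 729, 14411, -15192, -11530, 10906, 676],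
   [0, 15087, -4226, -537843, 546638, 519698, -515735, -8543, 18533, -9386, 729, -15192, 14411, 10906, -11530, 676]]

/-- An entry of the approximate inverse. -/
def approxInverseEntry (i k : ℕ) : ℤ := (approxInverse.getD i []).getD k 0

/-- The balls of radius `r` about the coordinates of the approximate zero. -/
def centerBalls (r : ℕ) : List (ℤ × ℕ) := center.map fun c => (c, r)

/-- The sum of the balls `f 0, …, f (n - 1)`. -/
def ballSum (f : ℕ → ℤ × ℕ) : ℕ → ℤ × ℕ
  | 0 => (0, 0)
  | n + 1 => ballAdd (ballSum f n) (f n)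

/-- The sum of the natural numbers `f 0, …, f (n - 1)`. -/
def natSum (f : ℕ → ℕ) : ℕ → ℕ
  | 0 => 0
  | n + 1 => natSum f n + f n

/-- Whether `p` holds for `0, …, n - 1`. -/
def allBelow (p : ℕ → Bool) : ℕ → Bool
  | 0 => true
  | n + 1 => allBelow p n && p n

/-- The enclosure of an entry of the defect `10 ^ 5 (C DH - 1)` over the ball of radius
`r / scale`. -/
def defectBall (r i j : ℕ) : ℤ × ℕ :=
  ballAdd
    (ballSum (fun k => ballSmul (approxInverseEntry i k)
      (ballPoly scale (centerBalls r) (polyDeriv j (extendedPoly k)))) 16)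
    (if i = j then -(10 ^ 5 * scale : ℕ) else 0, 0)

/-- The enclosure of a component of `10 ^ 5 C H` at the approximate zero. -/
def residualBall (i : ℕ) : ℤ × ℕ :=
  ballSum (fun k => ballSmul (approxInverseEntry i k)
    (ballPoly scale (centerBalls 0) (extendedPoly k))) 16

/-- The quantity bounded is `10 ^ 5 * 10 ^ 56` times a component of `C H(z̃)`, so `10 ^ 16` amounts
to `10⁻⁴⁵`. -/
theorem residual_check :
    allBelow (fun i => Nat.ble (ballBound (residualBall i)) (10 ^ 16)) 16 = true := by
  decide +kernel

/-- The radius `10 ^ 50` is `10⁻⁶` in units of the scale. The claim is that every absolute row sum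
of `C DH - 1` is at most `1/2` on that ball; the maximal row sum is the operator norm for the sup
norm. -/
theorem defect_check : allBelow (fun i => Nat.ble
    (natSum (fun j => ballBound (defectBall (10 ^ 50) i j)) 16 * 2) (10 ^ 5 * scale)) 16 = true := by
  decide +kernel

/-! ### The derivatives of the Dziobek equations -/

/-- The values `(x, m, v, w)` of the variables `X_0, …, X_22`. -/
noncomputable def point (x : Fin 8 → ℝ) (m : ℝ) (v w : Fin 7 → ℝ) : ℕ → ℝ := fun i =>
  [x 0, x 1, x 2, x 3, x 4, x 5, x 6, x 7, m, v 0, v 1, v 2, v 3, v 4, v 5, v 6,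
    w 0, w 1, w 2, w 3, w 4, w 5, w 6].getD i 0

theorem point_coord (x : Fin 8 → ℝ) (m : ℝ) (v w : Fin 7 → ℝ) (j : Fin 8) :
    point x m v w j = x j := by
  fin_cases j <;> rfl

theorem contDiff_point {N : WithTop ℕ∞} {E : Type*} [NormedAddCommGroup E] [NormedSpace ℝ E]
    {x : E → Fin 8 → ℝ} {m : E → ℝ} {v w : E → Fin 7 → ℝ} (hx : ContDiff ℝ N x)
    (hm : ContDiff ℝ N m) (hv : ContDiff ℝ N v) (hw : ContDiff ℝ N w) (i : ℕ) :
    ContDiff ℝ N fun e => point (x e) (m e) (v e) (w e) i := by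
  rw [contDiff_pi] at hx hv hw
  by_cases hi : i < 23
  · interval_cases i <;> simp only [point, List.getD_cons_zero, List.getD_cons_succ] <;>
      first | exact hm | exact hx _ | exact hv _ | exact hw _
  · obtain ⟨k, rfl⟩ := Nat.exists_eq_add_of_le' (not_lt.1 hi)
    exact contDiff_const

theorem hasFDerivAt_point_left (x : Fin 8 → ℝ) (m : ℝ) (v w : Fin 7 → ℝ) (i : ℕ) :
    HasFDerivAt (fun y => point y m v w i)
      (if h : i < 8 then ContinuousLinearMap.proj (R := ℝ) (φ := fun _ : Fin 8 => ℝ) ⟨i, h⟩ else 0)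
      x := by
  by_cases h : i < 8
  · rw [dif_pos h]
    have : (fun y => point y m v w i) = fun y => y ⟨i, h⟩ :=
      funext fun y => point_coord y m v w ⟨i, h⟩
    rw [this]
    exact hasFDerivAt_apply _ _
  · rw [dif_neg h]
    obtain ⟨k, rfl⟩ := Nat.exists_eq_add_of_le' (not_lt.1 h)
    exact hasFDerivAt_const (point 0 m v w (k + 8)) x

theorem hasFDerivAt_polyEval_left (x : Fin 8 → ℝ) (m : ℝ) (v w : Fin 7 → ℝ) (p : Poly) :
    HasFDerivAt (fun y => polyEval (point y m v w) p)
      (∑ j : Fin 8, polyEval (point x m v w) (polyDeriv j p) •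
        ContinuousLinearMap.proj (R := ℝ) (φ := fun _ : Fin 8 => ℝ) j) x := by
  refine (hasFDerivAt_polyEval (n := 8) (hasFDerivAt_point_left x m v w)
    (fun i hi => dif_neg (not_lt.2 hi)) p).congr_fderiv ?_
  rw [Finset.sum_range]
  simp

theorem partialDeriv_polyEval (m : ℝ) (v w : Fin 7 → ℝ) (p : Poly) (k : Fin 8) (x : Fin 8 → ℝ) :
    partialDeriv (fun y => polyEval (point y m v w) p) k x
      = polyEval (point x m v w) (polyDeriv k p) := by
  have h := hasFDerivAt_polyEval_left x m v w p
  rw [← Function.update_eq_self k x] at h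
  have := (h.comp_hasDerivAt (x k) (hasDerivAt_update x k (x k))).deriv
  rw [partialDeriv]
  simpa [Pi.single_apply, Function.comp_def] using this

theorem hasDerivAt_polyEval_mass (x : Fin 8 → ℝ) (m : ℝ) (v w : Fin 7 → ℝ) (p : Poly) :
    HasDerivAt (fun t => polyEval (point x t v w) p)
      (polyEval (point x m v w) (polyDeriv 8 p)) m := by
  have h : ∀ i, HasFDerivAt (fun t => point x t v w i)
      (if i = 8 then ContinuousLinearMap.id ℝ ℝ else 0) m := by
    intro i
    rcases lt_trichotomy i 8 with hi | rfl | hi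
    · rw [if_neg hi.ne]
      exact (hasFDerivAt_const (x ⟨i, hi⟩) m).congr_of_eventuallyEq
        (Filter.Eventually.of_forall fun t => point_coord x t v w ⟨i, hi⟩)
    · exact hasFDerivAt_id m
    · rw [if_neg hi.ne']
      obtain ⟨k, rfl⟩ := Nat.exists_eq_add_of_le' (Nat.succ_le_of_lt hi)
      exact hasFDerivAt_const (point x 0 v w (k + 9)) m
  have := (hasFDerivAt_polyEval (n := 9) h (fun i hi => if_neg (by omega)) p).hasDerivAt
  simpa [Finset.sum_ite_eq] using this

theorem cayleyMenger_eq (x : Fin 8 → ℝ) (m : ℝ) (v w : Fin 7 → ℝ) :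
    cayleyMenger x = polyEval (point x m v w) cayleyMengerPoly := by
  simp [cayleyMenger, cayleyMengerPoly, point, Matrix.det_succ_row_zero, Fin.sum_univ_succ,
    Fin.succAbove]
  ring

theorem polyEval_distancePoly (x : Fin 8 → ℝ) (m : ℝ) (v w : Fin 7 → ℝ) (q : Mono) (k : Fin 8) :
    polyEval (point x m v w) (distancePoly q k)
      = distanceEquation (masses m) (monoEval (point x m v w) q) k x := by
  have h : partialDeriv cayleyMenger k x
      = polyEval (point x m v w) (polyDeriv k cayleyMengerPoly) := by
    rw [← partialDeriv_polyEval]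
    congr 1
    exact funext fun y => cayleyMenger_eq y m v w
  simp only [distancePoly, polyEval_append, polyEval_termMul, polyEval_cons, polyEval_nil,
    monoEval_mul, monoEval_cons, monoEval_nil, point_coord, distanceEquation, h, totalMass]
  simp [point, masses, Fin.sum_univ_four]
  ring

theorem F_apply (x : Fin 8 → ℝ) (m : ℝ) (v w : Fin 7 → ℝ) (k : Fin 8) :
    F x m k = polyEval (point x m v w) (dziobekPoly k) := by
  have hI0 : Finset.Ioi (0 : Fin 4) = {1, 2, 3} := by decide
  have hI1 : Finset.Ioi (1 : Fin 4) = {2, 3} := by decide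
  have hI2 : Finset.Ioi (2 : Fin 4) = {3} := by decide
  have hI3 : Finset.Ioi (3 : Fin 4) = ∅ := by decide
  have hd := polyEval_distancePoly x m v w
  fin_cases k
  · simp [F, dziobek, dziobekPoly, Fin.sum_univ_four, hI0, hI1, hI2, hI3, dist, totalMass, masses,
      point]
    ring
  · exact cayleyMenger_eq x m v w
  · refine Eq.trans ?_ (hd [] 2).symm
    simp [F, dziobek, masses]
  · refine Eq.trans ?_ (hd [(8, 1)] 3).symm
    simp [F, dziobek, masses, point]
  · refine Eq.trans ?_ (hd [(8, 1)] 4).symm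
    simp [F, dziobek, masses, point]
  · refine Eq.trans ?_ (hd [(8, 1)] 5).symm
    simp [F, dziobek, masses, point]
  · refine Eq.trans ?_ (hd [(8, 1)] 6).symm
    simp [F, dziobek, masses, point]
  · refine Eq.trans ?_ (hd [(8, 2)] 7).symm
    simp [F, dziobek, masses, point, pow_two]

theorem contDiff_F {N : WithTop ℕ∞} :
    ContDiff ℝ N fun p : (Fin 8 → ℝ) × ℝ => F p.1 p.2 := by
  refine contDiff_pi.2 fun k => ?_
  simp only [F_apply _ _ 0 0]
  exact contDiff_polyEval
    (contDiff_point contDiff_fst contDiff_snd contDiff_const contDiff_const) _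

theorem hasFDerivAt_F_apply (x : Fin 8 → ℝ) (m : ℝ) (v w : Fin 7 → ℝ) (k : Fin 8) :
    HasFDerivAt (fun y => F y m k)
      (∑ j : Fin 8, polyEval (point x m v w) (polyDeriv j (dziobekPoly k)) •
        ContinuousLinearMap.proj (R := ℝ) (φ := fun _ : Fin 8 => ℝ) j) x := by
  simp only [F_apply _ _ v w]
  exact hasFDerivAt_polyEval_left x m v w _

theorem hasFDerivAt_F (x : Fin 8 → ℝ) (m : ℝ) (v w : Fin 7 → ℝ) :
    HasFDerivAt (fun y => F y m)
      (ContinuousLinearMap.pi fun k : Fin 8 =>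
        ∑ j : Fin 8, polyEval (point x m v w) (polyDeriv j (dziobekPoly k)) •
          ContinuousLinearMap.proj (R := ℝ) (φ := fun _ : Fin 8 => ℝ) j) x :=
  hasFDerivAt_pi.2 fun k => hasFDerivAt_F_apply x m v w k

theorem DF_apply (x : Fin 8 → ℝ) (m : ℝ) (v w : Fin 7 → ℝ) (k j : Fin 8) :
    DF x m k j = polyEval (point x m v w) (polyDeriv j (dziobekPoly k)) := by
  rw [DF, (hasFDerivAt_F x m v w).fderiv, LinearMap.toMatrix'_apply]
  simp [Pi.single_apply]

theorem DF_mulVec (x : Fin 8 → ℝ) (m : ℝ) (u : Fin 8 → ℝ) :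
    (DF x m).mulVec u = fderiv ℝ (fun y => F y m) x u :=
  LinearMap.toMatrix'_mulVec _ _

theorem hasDerivAt_F_mass (x : Fin 8 → ℝ) (m : ℝ) (v w : Fin 7 → ℝ) :
    HasDerivAt (fun t => F x t)
      (fun k : Fin 8 => polyEval (point x m v w) (polyDeriv 8 (dziobekPoly k))) m := by
  refine hasDerivAt_pi.2 fun k => ?_
  simp only [F_apply _ _ v w]
  exact hasDerivAt_polyEval_mass x m v w _

theorem Fm_apply (x : Fin 8 → ℝ) (m : ℝ) (v w : Fin 7 → ℝ) (k : Fin 8) :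
    Fm x m k = polyEval (point x m v w) (polyDeriv 8 (dziobekPoly k)) := by
  rw [Fm, (hasDerivAt_F_mass x m v w).deriv]

/-- The second derivative is computed as the derivative in direction `a` of `y ↦ DF(y) b`, whose
components are again polynomials in `y`. -/
theorem D2F_apply (x : Fin 8 → ℝ) (m : ℝ) (v w : Fin 7 → ℝ) (a b : Fin 8 → ℝ) (k : Fin 8) :
    D2F x m a b k = ∑ i : Fin 8, ∑ j : Fin 8,
      polyEval (point x m v w) (polyDeriv i (polyDeriv j (dziobekPoly k))) * a i * b j := by
  have hF : ContDiff ℝ 2 fun y => F y m := by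
    refine contDiff_pi.2 fun k => ?_
    simp only [F_apply _ _ 0 0]
    exact contDiff_polyEval
      (contDiff_point contDiff_id contDiff_const contDiff_const contDiff_const) _
  have hd : DifferentiableAt ℝ (fderiv ℝ fun y => F y m) x :=
    ((hF.fderiv_right (m := 1) (by norm_num)).differentiable (by norm_num)).differentiableAt
  have h0 := hd.hasFDerivAt.clm_apply (hasFDerivAt_const b x)
  have h1 := hasFDerivAt_pi'.1 h0 k
  have h2 : HasFDerivAt (fun y => fderiv ℝ (fun y => F y m) y b k)
      (∑ j : Fin 8, b j • ∑ i : Fin 8,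
        polyEval (point x m v w) (polyDeriv i (polyDeriv j (dziobekPoly k))) •
        ContinuousLinearMap.proj (R := ℝ) (φ := fun _ : Fin 8 => ℝ) i) x := by
    have e : (fun y => fderiv ℝ (fun y => F y m) y b k) = fun y => ∑ j : Fin 8,
        b j * polyEval (point y m v w) (polyDeriv j (dziobekPoly k)) := by
      funext y
      rw [(hasFDerivAt_F y m v w).fderiv]
      simp [mul_comm]
    rw [e]
    exact HasFDerivAt.fun_sum fun j _ => (hasFDerivAt_polyEval_left x m v w _).const_mul (b j)
  have h3 := congrArg (fun L => L a) (h1.unique h2)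
  rw [D2F, iteratedFDeriv_two_apply]
  simp only [Matrix.cons_val_zero, Matrix.cons_val_one]
  simp only [ContinuousLinearMap.comp_zero, zero_add, ContinuousLinearMap.comp_apply,
    ContinuousLinearMap.flip_apply, ContinuousLinearMap.proj_apply, _root_.sum_apply,
    _root_.smul_apply, smul_eq_mul, Finset.mul_sum] at h3
  rw [h3, Finset.sum_comm]
  exact Finset.sum_congr rfl fun i _ => Finset.sum_congr rfl fun j _ => by ring

end FourBody

/-! ### Fold bifurcations -/

/-- Since `deriv μ` vanishes at 0 and has positive derivative there, it has the sign of `s` near 0.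
-/
theorem exists_strictMono_of_deriv_deriv_pos {μ : ℝ → ℝ} {a : ℝ} (ha : 0 < a)
    (hμ : ContinuousOn μ (Set.Ioo (-a) a)) (h1 : deriv μ 0 = 0) (h2 : 0 < deriv (deriv μ) 0) :
    ∃ c > 0, ∀ b, 0 < b → b < c → StrictAntiOn μ (Set.Icc (-b) 0) ∧
      StrictMonoOn μ (Set.Icc 0 b) := by
  obtain ⟨c, hc, h⟩ := Metric.eventually_nhds_iff.1
    (eventually_nhdsWithin_sign_eq_of_deriv_pos h2 h1)
  refine ⟨min a c, lt_min ha hc, fun b hb hbc => ⟨?_, ?_⟩⟩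
  · refine strictAntiOn_of_deriv_neg (convex_Icc _ _) (hμ.mono fun s hs => ?_) fun s hs => ?_
    · exact ⟨by linarith [hs.1, min_le_left a c], by linarith [hs.2]⟩
    · rw [interior_Icc] at hs
      have := @h s (by rw [Real.dist_0_eq_abs, abs_lt]; constructor <;>
        linarith [hs.1, hs.2, min_le_right a c])
      rwa [sub_zero, sign_neg hs.2, sign_eq_neg_one_iff] at this
  · refine strictMonoOn_of_deriv_pos (convex_Icc _ _) (hμ.mono fun s hs => ?_) fun s hs => ?_
    · exact ⟨by linarith [hs.1], by linarith [hs.2, min_le_left a c]⟩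
    · rw [interior_Icc] at hs
      have := @h s (by rw [Real.dist_0_eq_abs, abs_lt]; constructor <;>
        linarith [hs.1, hs.2, min_le_right a c])
      rwa [sub_zero, sign_pos hs.1, sign_eq_one_iff] at this

/-- The curve is parametrized by the displacement of the `i`-th coordinate, so counting solutions at
a given parameter value amounts to counting the `s` at which `μ` takes this value. As `μ` falls and
then rises through its minimum `μ₀` at 0, there are none, one or two. -/
theorem card_solutions_of_curve {n : ℕ} {G : (Fin n → ℝ) → ℝ → (Fin n → ℝ)} {x₀ : Fin n → ℝ}
    {μ₀ : ℝ} (i : Fin n) {a : ℝ} (ha : 0 < a) {γ : ℝ → Fin n → ℝ} {μ : ℝ → ℝ}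
    (hγ : ContinuousOn γ (Set.Ioo (-a) a)) (hμ : ContinuousOn μ (Set.Ioo (-a) a))
    (hγ0 : γ 0 = x₀) (hμ0 : μ 0 = μ₀) (h1 : deriv μ 0 = 0) (h2 : 0 < deriv (deriv μ) 0)
    (hi : ∀ s ∈ Set.Ioo (-a) a, γ s i = x₀ i + s)
    (hsol : ∀ s ∈ Set.Ioo (-a) a, G (γ s) (μ s) = 0)
    (hloc : ∀ᶠ p in nhds (x₀, μ₀), G p.1 p.2 = 0 →
      ∃ s ∈ Set.Ioo (-a) a, γ s = p.1 ∧ μ s = p.2) :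
    ∀ W ∈ nhds x₀, ∃ U ⊆ W, IsOpen U ∧ x₀ ∈ U ∧ ∃ δ > 0,
      (∀ μ ∈ Set.Ioo (μ₀ - δ) μ₀, {x ∈ U | G x μ = 0} = ∅) ∧
      {x ∈ U | G x μ₀ = 0} = {x₀} ∧
      ∀ μ ∈ Set.Ioo μ₀ (μ₀ + δ), {x ∈ U | G x μ = 0}.ncard = 2 := by
  intro W hW
  obtain ⟨c, hc, hmono⟩ := exists_strictMono_of_deriv_deriv_pos ha hμ h1 h2
  obtain ⟨r, hr, hloc⟩ := Metric.eventually_nhds_iff.1 hloc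
  have hW' : interior W ∩ Metric.ball x₀ r ∈ nhds (γ 0) := by
    rw [hγ0]
    exact Filter.inter_mem (interior_mem_nhds.2 hW) (Metric.ball_mem_nhds _ hr)
  obtain ⟨d, hd, hγW⟩ := Metric.eventually_nhds_iff.1
    ((hγ.continuousAt (Ioo_mem_nhds (neg_lt_zero.2 ha) ha)).eventually hW')
  obtain ⟨b, hb, hbm⟩ := exists_between (lt_min ha (lt_min hc hd))
  have hba : b < a := hbm.trans_le (min_le_left _ _)
  have hbc : b < c := hbm.trans_le ((min_le_right _ _).trans (min_le_left _ _))
  have hbd : b < d := hbm.trans_le ((min_le_right _ _).trans (min_le_right _ _))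
  obtain ⟨hanti, hmono⟩ := hmono b hb hbc
  have hsub : Set.Icc (-b) b ⊆ Set.Ioo (-a) a := fun s hs =>
    ⟨by linarith [hs.1], by linarith [hs.2]⟩
  -- The slab `|x i - x₀ i| < b` cuts the curve exactly at `|s| < b`, because `γ s i = x₀ i + s`.
  have key : ∀ m, |m - μ₀| < r →
      {x ∈ interior W ∩ Metric.ball x₀ r ∩ {x | |x i - x₀ i| < b} | G x m = 0}
        = γ '' {s ∈ Set.Ioo (-b) b | μ s = m} := by
    intro m hm
    ext x
    constructor
    · rintro ⟨⟨⟨-, hx⟩, hxi⟩, hG⟩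
      obtain ⟨s, hs, rfl, hs'⟩ := @hloc (x, m) (by
        rw [Prod.dist_eq]; exact max_lt hx (by simpa [Real.dist_eq] using hm)) hG
      refine ⟨s, ⟨?_, hs'⟩, rfl⟩
      rw [Set.mem_ofPred_eq, hi s hs, add_sub_cancel_left] at hxi
      exact abs_lt.1 hxi
    · rintro ⟨s, ⟨hs, rfl⟩, rfl⟩
      have hs' := hsub (Set.Ioo_subset_Icc_self hs)
      refine ⟨⟨@hγW s ?_, ?_⟩, hsol s hs'⟩
      · rw [Real.dist_0_eq_abs, abs_lt]
        exact ⟨by linarith [hs.1], by linarith [hs.2]⟩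
      · rw [Set.mem_ofPred_eq, hi s hs', add_sub_cancel_left]
        exact abs_lt.2 hs
  have hpos : ∀ s, 0 < s → s ≤ b → μ₀ < μ s := fun s hs hsb => by
    rw [← hμ0]; exact hmono ⟨le_rfl, hb.le⟩ ⟨hs.le, hsb⟩ hs
  have hneg : ∀ s, s < 0 → -b ≤ s → μ₀ < μ s := fun s hs hsb => by
    rw [← hμ0]; exact hanti ⟨hsb, hs.le⟩ ⟨by linarith, le_rfl⟩ hs
  -- In the choice of `δ`, the bound `r` keeps the parameter in the range where every solution lies
  -- on the curve; the other two keep it below `μ b` and `μ (-b)`, so that the intermediate value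
  -- theorem yields a solution on either side of 0.
  refine ⟨interior W ∩ Metric.ball x₀ r ∩ {x | |x i - x₀ i| < b},
    fun x hx => interior_subset hx.1.1, (isOpen_interior.inter Metric.isOpen_ball).inter
    (isOpen_lt (by fun_prop) continuous_const), ⟨⟨mem_interior_iff_mem_nhds.2 hW,
      Metric.mem_ball_self hr⟩, by simpa using hb⟩,
    min r (min (μ b - μ₀) (μ (-b) - μ₀)), lt_min hr (lt_min ?_ ?_), ?_, ?_, ?_⟩
  · exact sub_pos.2 (hpos b hb le_rfl)
  · exact sub_pos.2 (hneg (-b) (by linarith) le_rfl)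
  · intro m hm
    rw [key m (by
      rw [abs_lt]; constructor <;> linarith [hm.1, hm.2, min_le_left r
        (min (μ b - μ₀) (μ (-b) - μ₀))])]
    rw [Set.image_eq_empty, Set.eq_empty_iff_forall_notMem]
    rintro s ⟨hs, rfl⟩
    rcases lt_trichotomy s 0 with h | rfl | h
    · exact absurd (hneg s h hs.1.le) (not_lt.2 hm.2.le)
    · exact absurd hm.2 (by rw [hμ0]; exact lt_irrefl _)
    · exact absurd (hpos s h hs.2.le) (not_lt.2 hm.2.le)
  · rw [key μ₀ (by simpa using hr)]
    have : {s ∈ Set.Ioo (-b) b | μ s = μ₀} = {0} := by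
      ext s
      constructor
      · rintro ⟨hs, hs'⟩
        rcases lt_trichotomy s 0 with h | h | h
        · exact absurd hs' (hneg s h hs.1.le).ne'
        · exact h
        · exact absurd hs' (hpos s h hs.2.le).ne'
      · rintro rfl
        exact ⟨⟨by linarith, hb⟩, hμ0⟩
    rw [this, Set.image_singleton, hγ0]
  · intro m hm
    have hm1 : m < μ₀ + r := hm.2.trans_le (by gcongr; exact min_le_left _ _)
    have hm2 : m < μ b := by
      have := min_le_left (μ b - μ₀) (μ (-b) - μ₀)
      linarith [hm.2, min_le_right r (min (μ b - μ₀) (μ (-b) - μ₀))]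
    have hm3 : m < μ (-b) := by
      have := min_le_right (μ b - μ₀) (μ (-b) - μ₀)
      linarith [hm.2, min_le_right r (min (μ b - μ₀) (μ (-b) - μ₀))]
    obtain ⟨s, hs, hsm⟩ := intermediate_value_Ioo hb.le
      (hμ.mono ((Set.Icc_subset_Icc_left (by linarith)).trans hsub)) ⟨by rw [hμ0]; exact hm.1, hm2⟩
    obtain ⟨t, ht, htm⟩ := intermediate_value_Ioo' (neg_nonpos.2 hb.le)
      (hμ.mono ((Set.Icc_subset_Icc_right hb.le).trans hsub)) ⟨by rw [hμ0]; exact hm.1, hm3⟩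
    have hst : {s ∈ Set.Ioo (-b) b | μ s = m} = {t, s} := by
      ext u
      constructor
      · rintro ⟨hu, hum⟩
        rcases le_total u 0 with h | h
        · exact Or.inl (hanti.injOn ⟨hu.1.le, h⟩ ⟨ht.1.le, ht.2.le⟩ (hum.trans htm.symm))
        · exact Or.inr (hmono.injOn ⟨h, hu.2.le⟩ ⟨hs.1.le, hs.2.le⟩ (hum.trans hsm.symm))
      · rintro (rfl | rfl)
        · exact ⟨⟨ht.1, by linarith [ht.2]⟩, htm⟩
        · exact ⟨⟨by linarith [hs.1], hs.2⟩, hsm⟩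
    rw [key m (by rw [abs_lt]; constructor <;> linarith [hm.1]), hst, Set.image_pair]
    refine Set.ncard_pair fun h => ?_
    have h' := congrFun h i
    rw [hi t (hsub ⟨ht.1.le, by linarith [ht.2]⟩), hi s (hsub ⟨by linarith [hs.1], hs.2.le⟩)] at h'
    linarith [hs.1, ht.2]

theorem fderiv_prodMk_left {E F : Type*} [NormedAddCommGroup E] [NormedSpace ℝ E]
    [NormedAddCommGroup F] [NormedSpace ℝ F] {g : E × ℝ → F} {x : E} {μ : ℝ}
    (hg : DifferentiableAt ℝ g (x, μ)) (u : E) :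
    fderiv ℝ (fun y => g (y, μ)) x u = fderiv ℝ g (x, μ) (u, 0) := by
  have h := (hg.hasFDerivAt.comp x (hasFDerivAt_prodMk_left (𝕜 := ℝ) x μ)).fderiv
  rw [show (fun y => g (y, μ)) = g ∘ fun y => (y, μ) from rfl, h]
  simp

theorem deriv_prodMk_right {E F : Type*} [NormedAddCommGroup E] [NormedSpace ℝ E]
    [NormedAddCommGroup F] [NormedSpace ℝ F] {g : E × ℝ → F} {x : E} {μ : ℝ}
    (hg : DifferentiableAt ℝ g (x, μ)) :
    deriv (fun t => g (x, t)) μ = fderiv ℝ g (x, μ) (0, 1) := by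
  have h := (hg.hasFDerivAt.comp μ (hasFDerivAt_prodMk_right (𝕜 := ℝ) x μ)).hasDerivAt.deriv
  rw [show (fun t => g (x, t)) = g ∘ fun t => (x, t) from rfl, h]
  simp

open scoped ContDiff in
theorem iteratedFDeriv_two_prodMk_left {E F : Type*} [NormedAddCommGroup E] [NormedSpace ℝ E]
    [NormedAddCommGroup F] [NormedSpace ℝ F] {g : E × ℝ → F} (hg : ContDiff ℝ ω g) (x : E) (μ : ℝ)
    (v : E) :
    iteratedFDeriv ℝ 2 (fun y => g (y, μ)) x ![v, v]
      = fderiv ℝ (fderiv ℝ g) (x, μ) (v, 0) (v, 0) := by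
  have hg1 : Differentiable ℝ g := hg.differentiable (by simp)
  have hg2 : Differentiable ℝ (fderiv ℝ g) :=
    (hg.fderiv_right (m := 1) le_top).differentiable (by simp)
  have hx : ContDiff ℝ ω fun y => g (y, μ) := hg.comp (contDiff_id.prodMk contDiff_const)
  have hx2 : DifferentiableAt ℝ (fderiv ℝ fun y => g (y, μ)) x :=
    (hx.fderiv_right (m := 1) le_top).differentiable (by simp) x
  rw [iteratedFDeriv_two_apply]
  simp only [Matrix.cons_val_zero, Matrix.cons_val_one]
  have h1 := hx2.hasFDerivAt.clm_apply (hasFDerivAt_const v x)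
  have h2 := (hg2 (x, μ)).hasFDerivAt.clm_apply (hasFDerivAt_const ((v, 0) : E × ℝ) (x, μ))
  have h3 := fderiv_prodMk_left h2.differentiableAt v
  rw [h2.fderiv] at h3
  have h4 : (fun y => fderiv ℝ g (y, μ) (v, 0)) = fun y => fderiv ℝ (fun y => g (y, μ)) y v :=
    funext fun y => (fderiv_prodMk_left (hg1 _) v).symm
  rw [h4, h1.fderiv] at h3
  simpa using h3

open scoped ContDiff in
/-- Sufficient conditions for a fold bifurcation: a simple zero eigenvalue with right null vector
`v` and left null vector `w`, transversality `w · G_μ > 0` and nondegeneracy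
`w · D²G(v, v) < 0`. -/
theorem isFoldBifurcation_of_nondegenerate {n : ℕ} {G : (Fin n → ℝ) → ℝ → (Fin n → ℝ)}
    {x₀ : Fin n → ℝ} {μ₀ : ℝ}
    (hG : ContDiff ℝ ω fun p : (Fin n → ℝ) × ℝ => G p.1 p.2) (h0 : G x₀ μ₀ = 0)
    {v w : Fin n → ℝ} (i : Fin n) (hvi : v i = 1)
    (hker : ∀ u, fderiv ℝ (fun y => G y μ₀) x₀ u = 0 → ∃ c : ℝ, u = c • v)
    (hw : ∀ u, w ⬝ᵥ fderiv ℝ (fun y => G y μ₀) x₀ u = 0)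
    (hm : 0 < w ⬝ᵥ deriv (fun t => G x₀ t) μ₀)
    (h2 : w ⬝ᵥ iteratedFDeriv ℝ 2 (fun y => G y μ₀) x₀ ![v, v] < 0) :
    IsFoldBifurcation G x₀ μ₀ := by
  set g : (Fin n → ℝ) × ℝ → Fin n → ℝ := fun p => G p.1 p.2 with hg
  have hgd : Differentiable ℝ g := hG.differentiable (by simp)
  set A := fderiv ℝ (fun y => G y μ₀) x₀ with hA
  set b := deriv (fun t => G x₀ t) μ₀ with hb
  have hAb : ∀ p, fderiv ℝ g (x₀, μ₀) p = A p.1 + p.2 • b := by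
    rintro ⟨u, t⟩
    have e : ((u, t) : (Fin n → ℝ) × ℝ) = (u, 0) + t • (0, 1) := by ext <;> simp
    have e1 := fderiv_prodMk_left (hgd (x₀, μ₀)) u
    have e2 := deriv_prodMk_right (hgd (x₀, μ₀))
    rw [e, map_add, map_smul, ← e1, ← e2]
    simp [hA, hb, hg]
  have hwAb : ∀ p, w ⬝ᵥ fderiv ℝ g (x₀, μ₀) p = p.2 * (w ⬝ᵥ b) := fun p => by
    rw [hAb, dotProduct_add, hw, zero_add, dotProduct_smul, smul_eq_mul]
  -- Pairing with `w` kills the `x`-part, so transversality forces the parameter component of a null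
  -- direction to vanish; what remains lies in the kernel spanned by `v`.
  have hkey : ∀ p : (Fin n → ℝ) × ℝ, fderiv ℝ g (x₀, μ₀) p = 0 → p = (p.1 i • v, 0) := by
    intro p hp
    have h := hwAb p
    rw [hp, dotProduct_zero, eq_comm, mul_eq_zero] at h
    have hp2 : p.2 = 0 := h.resolve_right hm.ne'
    rw [hAb, hp2, zero_smul, add_zero] at hp
    obtain ⟨c, hc⟩ := hker _ hp
    have : p.1 i = c := by rw [hc]; simp [hvi]
    rw [this, ← hc, ← hp2]
  -- Adding the coordinate `x i - x₀ i`, which is nonzero along `v`, makes the derivative injective.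
  -- The inverse function theorem then straightens the solution set to `{0} × ℝ`.
  let Φ : (Fin n → ℝ) × ℝ → (Fin n → ℝ) × ℝ := fun p => (g p, p.1 i - x₀ i)
  let L : (Fin n → ℝ) × ℝ →L[ℝ] (Fin n → ℝ) × ℝ := (fderiv ℝ g (x₀, μ₀)).prod
    ((ContinuousLinearMap.proj (R := ℝ) (φ := fun _ : Fin n => ℝ) i).comp
      (ContinuousLinearMap.fst ℝ _ _))
  have hΦL : HasFDerivAt Φ L (x₀, μ₀) :=
    (hgd _).hasFDerivAt.prodMk ((ContinuousLinearMap.hasFDerivAt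
      ((ContinuousLinearMap.proj (R := ℝ) (φ := fun _ : Fin n => ℝ) i).comp
        (ContinuousLinearMap.fst ℝ (Fin n → ℝ) ℝ))).sub_const (x₀ i))
  have hinj : Function.Injective (L : (Fin n → ℝ) × ℝ →ₗ[ℝ] (Fin n → ℝ) × ℝ) := by
    rw [injective_iff_map_eq_zero]
    intro p hp
    have hp1 : fderiv ℝ g (x₀, μ₀) p = 0 := congrArg Prod.fst hp
    have hp2 : p.1 i = 0 := congrArg Prod.snd hp
    rw [hkey p hp1, hp2]; simp
  let e := (LinearEquiv.ofInjectiveEndo _ hinj).toContinuousLinearEquiv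
  have he : (e : (Fin n → ℝ) × ℝ →L[ℝ] (Fin n → ℝ) × ℝ) = L := by ext <;> rfl
  have hΦe : HasFDerivAt Φ (e : (Fin n → ℝ) × ℝ →L[ℝ] (Fin n → ℝ) × ℝ) (x₀, μ₀) := he ▸ hΦL
  have hΦ : ContDiffAt ℝ ω Φ (x₀, μ₀) := by
    refine ContDiff.contDiffAt (hG.prodMk (ContDiff.sub ?_ contDiff_const))
    exact (contDiff_apply ℝ ℝ i).comp contDiff_fst
  have hω : (ω : WithTop ℕ∞) ≠ 0 := by simp
  have hΦ0 : Φ (x₀, μ₀) = (0, 0) := by simp [Φ, hg, h0]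
  have hψ : ContDiffAt ℝ ω (hΦ.localInverse hΦe hω) (0, 0) := hΦ0 ▸ hΦ.to_localInverse hΦe hω
  have hψ0 : hΦ.localInverse hΦe hω (0, 0) = (x₀, μ₀) :=
    hΦ0 ▸ hΦ.localInverse_apply_image hΦe hω
  have hright : ∀ᶠ q in nhds ((0, 0) : (Fin n → ℝ) × ℝ), Φ (hΦ.localInverse hΦe hω q) = q :=
    hΦ0 ▸ (hΦ.hasStrictFDerivAt' hΦe hω).eventually_right_inverse
  have hleft : ∀ᶠ p in nhds (x₀, μ₀), hΦ.localInverse hΦe hω (Φ p) = p :=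
    (hΦ.hasStrictFDerivAt' hΦe hω).eventually_left_inverse
  generalize hΦ.localInverse hΦe hω = ψ at hψ hψ0 hright hleft
  let c : ℝ → (Fin n → ℝ) × ℝ := fun s => ψ (0, s)
  have hc : ContDiffAt ℝ ω c 0 := ContDiffAt.comp (g := ψ) (0 : ℝ) hψ
    (contDiff_const.prodMk contDiff_id).contDiffAt
  have hcont : ContinuousAt (fun s : ℝ => ((0, s) : (Fin n → ℝ) × ℝ)) 0 := by fun_prop
  have hΦc : ∀ᶠ s in nhds (0 : ℝ), Φ (c s) = (0, s) := hcont.eventually hright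
  -- Analyticity at a point persists on a neighbourhood. For `C^∞` at a point the neighbourhood may
  -- depend on the order, which is why the argument works with `ω`.
  obtain ⟨a, ha, hs⟩ := Metric.eventually_nhds_iff.1 ((hc.eventually (by simp)).and hΦc)
  replace hs : ∀ s ∈ Set.Ioo (-a) a, ContDiffAt ℝ ω c s ∧ Φ (c s) = (0, s) := fun s h =>
    hs (by rw [Real.dist_0_eq_abs]; exact abs_lt.2 h)
  have h0a : (0 : ℝ) ∈ Set.Ioo (-a) a := ⟨neg_lt_zero.2 ha, ha⟩
  have hG0 : ∀ s ∈ Set.Ioo (-a) a, g (c s) = 0 := fun s h => congrArg Prod.fst (hs s h).2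
  have hci : ∀ s ∈ Set.Ioo (-a) a, (c s).1 i = x₀ i + s := fun s h => by
    have : (c s).1 i - x₀ i = s := congrArg Prod.snd (hs s h).2
    linarith
  have hc1 : ∀ s ∈ Set.Ioo (-a) a, HasDerivAt c (deriv c s) s := fun s h =>
    ((hs s h).1.differentiableAt hω).hasDerivAt
  have hgc : ∀ s ∈ Set.Ioo (-a) a, fderiv ℝ g (c s) (deriv c s) = 0 := fun s h => by
    have h1 := (hgd (c s)).hasFDerivAt.comp_hasDerivAt s (hc1 s h)
    refine h1.unique ((hasDerivAt_const s (0 : Fin n → ℝ)).congr_of_eventuallyEq ?_)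
    filter_upwards [isOpen_Ioo.mem_nhds h] with t ht using hG0 t ht
  have hc0 : c 0 = (x₀, μ₀) := hψ0
  have hdi : (deriv c 0).1 i = 1 := by
    have h1 : HasDerivAt (fun s => (c s).1 i) ((deriv c 0).1 i) 0 :=
      (hasDerivAt_pi.1 (hc1 0 h0a).fst) i
    refine h1.unique (((hasDerivAt_id (0 : ℝ)).const_add (x₀ i)).congr_of_eventuallyEq ?_)
    filter_upwards [isOpen_Ioo.mem_nhds h0a] with t ht using hci t ht
  have hdc : deriv c 0 = (v, 0) := by
    have h1 := hgc 0 h0a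
    rw [hc0] at h1
    have h2 := hkey _ h1
    rwa [hdi, one_smul] at h2
  have hd2 : HasDerivAt (deriv c) (deriv (deriv c) 0) 0 :=
    hc.analyticAt.deriv.differentiableAt.hasDerivAt
  -- This is the second derivative of `g (c s) = 0` at `s = 0`. Pairing it with `w` gives `w ·
  -- D²G(v, v) + μ''(0) (w · G_μ) = 0`, hence the sign of `μ''(0)`.
  have hsecond : fderiv ℝ (fderiv ℝ g) (x₀, μ₀) (v, 0) (v, 0)
      + fderiv ℝ g (x₀, μ₀) (deriv (deriv c) 0) = 0 := by
    have hg2 : Differentiable ℝ (fderiv ℝ g) :=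
      (hG.fderiv_right (m := 1) le_top).differentiable (by simp)
    have h1 : HasDerivAt (fun s => fderiv ℝ g (c s) (deriv c s))
        (fderiv ℝ (fderiv ℝ g) (c 0) (deriv c 0) (deriv c 0)
          + fderiv ℝ g (c 0) (deriv (deriv c) 0)) 0 :=
      ((hg2 (c 0)).hasFDerivAt.comp_hasDerivAt 0 (hc1 0 h0a)).clm_apply hd2
    rw [hdc, hc0] at h1
    refine h1.unique ((hasDerivAt_const (0 : ℝ) (0 : Fin n → ℝ)).congr_of_eventuallyEq ?_)
    filter_upwards [isOpen_Ioo.mem_nhds h0a] with t ht using hgc t ht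
  have hsnd : ∀ {f : ℝ → (Fin n → ℝ) × ℝ} {f' s}, HasDerivAt f f' s →
      HasDerivAt (fun s => (f s).2) f'.2 s := fun h => 
      (ContinuousLinearMap.snd ℝ (Fin n → ℝ) ℝ).hasFDerivAt.comp_hasDerivAt _ h
  have hμ' : ∀ s ∈ Set.Ioo (-a) a, deriv (fun s => (c s).2) s = (deriv c s).2 := fun s h =>
    (hsnd (hc1 s h)).deriv
  have hμ'' : deriv (deriv fun s => (c s).2) 0 = (deriv (deriv c) 0).2 := by
    refine ((hsnd hd2).congr_of_eventuallyEq ?_).deriv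
    filter_upwards [isOpen_Ioo.mem_nhds h0a] with t ht using hμ' t ht
  have hpos : 0 < deriv (deriv fun s => (c s).2) 0 := by
    have h3 := congrArg (fun u => w ⬝ᵥ u) hsecond
    simp only [dotProduct_add, dotProduct_zero, hwAb] at h3
    rw [← iteratedFDeriv_two_prodMk_left hG x₀ μ₀ v, ← hμ''] at h3
    by_contra hneg
    have : deriv (deriv fun s => (c s).2) 0 * w ⬝ᵥ b ≤ 0 :=
      mul_nonpos_of_nonpos_of_nonneg (not_lt.1 hneg) hm.le
    linarith
  have hμ0 : deriv (fun s => (c s).2) 0 = 0 := by rw [hμ' 0 h0a, hdc]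
  have hγ0 : deriv (fun s => (c s).1) 0 = v := by
    have h1 : HasDerivAt (fun s => (c s).1) (deriv c 0).1 0 :=
      (ContinuousLinearMap.fst ℝ (Fin n → ℝ) ℝ).hasFDerivAt.comp_hasDerivAt _ (hc1 0 h0a)
    rw [h1.deriv, hdc]
  have hloc : ∀ᶠ p in nhds (x₀, μ₀), G p.1 p.2 = 0 →
      ∃ s ∈ Set.Ioo (-a) a, (c s).1 = p.1 ∧ (c s).2 = p.2 := by
    have hci : ContinuousAt (fun p : (Fin n → ℝ) × ℝ => p.1 i - x₀ i) (x₀, μ₀) := by fun_prop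
    have hni : ∀ᶠ p : (Fin n → ℝ) × ℝ in nhds (x₀, μ₀), p.1 i - x₀ i ∈ Set.Ioo (-a) a :=
      hci.eventually (isOpen_Ioo.mem_nhds (by simpa using h0a))
    filter_upwards [hleft, hni] with p hp hpi hp0
    refine ⟨_, hpi, ?_⟩
    have : c (p.1 i - x₀ i) = p := by
      have h3 : Φ p = (0, p.1 i - x₀ i) := by simp [Φ, hg, hp0]
      rwa [h3] at hp
    rw [this]; exact ⟨rfl, rfl⟩
  have hγs : ContDiffOn ℝ ∞ (fun s => (c s).1) (Set.Ioo (-a) a) := fun s h =>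
    ((hs s h).1.of_le le_top).fst.contDiffWithinAt
  have hμs : ContDiffOn ℝ ∞ (fun s => (c s).2) (Set.Ioo (-a) a) := fun s h =>
    ((hs s h).1.of_le le_top).snd.contDiffWithinAt
  refine ⟨⟨a, ha, fun s => (c s).1, fun s => (c s).2, hγs, hμs, ?_, ?_, ?_, hμ0, hpos, hG0, hloc⟩,
    card_solutions_of_curve i ha hγs.continuousOn hμs.continuousOn ?_ ?_ hμ0 hpos hci hG0 hloc⟩
  · simp [hc0]
  · simp [hc0]
  · rw [hγ0]; intro h; simp [h] at hvi
  · simp [hc0]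
  · simp [hc0]

namespace FourBody

/-! ### The extended system -/

/-- The unknowns `(x, m, v)` of the extended system; the last coordinate of `v` is dropped. -/
def assemble (x : Fin 8 → ℝ) (m : ℝ) (v : Fin 8 → ℝ) : Fin 16 → ℝ :=
  ![x 0, x 1, x 2, x 3, x 4, x 5, x 6, x 7, m, v 0, v 1, v 2, v 3, v 4, v 5, v 6]

/-- The component `x` of the unknowns. -/
def xPart (z : Fin 16 → ℝ) : Fin 8 → ℝ := ![z 0, z 1, z 2, z 3, z 4, z 5, z 6, z 7]

/-- The component `v` of the unknowns, completed by `v₈ = 1`. -/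
def vPart (z : Fin 16 → ℝ) : Fin 8 → ℝ := ![z 9, z 10, z 11, z 12, z 13, z 14, z 15, 1]

/-- The values of the variables at the unknowns of the extended system. -/
noncomputable def unknowns (z : Fin 16 → ℝ) : ℕ → ℝ :=
  point (xPart z) (z 8) (fun j => vPart z j.castSucc) 0

/-- The extended system `(F, DF v)`. -/
noncomputable def extendedMap (z : Fin 16 → ℝ) : Fin 16 → ℝ :=
  fun k => polyEval (unknowns z) (extendedPoly k)

theorem assemble_parts (z : Fin 16 → ℝ) : assemble (xPart z) (z 8) (vPart z) = z := by
  funext i; fin_cases i <;> rfl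

theorem xPart_assemble (x : Fin 8 → ℝ) (m : ℝ) (v : Fin 8 → ℝ) : xPart (assemble x m v) = x := by
  funext i; fin_cases i <;> rfl

theorem vPart_assemble (x : Fin 8 → ℝ) (m : ℝ) {v : Fin 8 → ℝ} (hv : v 7 = 1) :
    vPart (assemble x m v) = v := by
  funext i; fin_cases i <;> first | rfl | exact hv.symm

theorem assemble_add_smul (x : Fin 8 → ℝ) (m : ℝ) (v u : Fin 8 → ℝ) (t : ℝ) :
    assemble x m (v + t • u) = assemble x m v + t • assemble 0 0 u := by
  funext i; fin_cases i <;> simp [assemble]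

theorem eq_zero_of_assemble_eq_zero {u : Fin 8 → ℝ} (h : assemble 0 0 u = 0) (h7 : u 7 = 0) :
    u = 0 := by
  funext i
  fin_cases i
  · exact congrFun h 9
  · exact congrFun h 10
  · exact congrFun h 11
  · exact congrFun h 12
  · exact congrFun h 13
  · exact congrFun h 14
  · exact congrFun h 15
  · exact h7

theorem unknowns_coord (z : Fin 16 → ℝ) (i : Fin 16) : unknowns z i = z i := by
  fin_cases i <;> rfl

theorem unknowns_of_le (z : Fin 16 → ℝ) {i : ℕ} (hi : 16 ≤ i) : unknowns z i = 0 := by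
  by_cases h : i < 23
  · interval_cases i <;> rfl
  · obtain ⟨k, rfl⟩ := Nat.exists_eq_add_of_le' (not_lt.1 h)
    rfl

theorem polyEval_polySum (ρ : ℕ → ℝ) (f : ℕ → Poly) (n : ℕ) :
    polyEval ρ (polySum f n) = ∑ j ∈ Finset.range n, polyEval ρ (f j) := by
  induction n with
  | zero => simp [polySum]
  | succ n ih => rw [polySum, polyEval_append, ih, Finset.sum_range_succ]

theorem extendedMap_castAdd (z : Fin 16 → ℝ) (k : Fin 8) :
    extendedMap z (Fin.castAdd 8 k) = F (xPart z) (z 8) k := by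
  rw [F_apply _ _ (fun j => vPart z j.castSucc) 0]
  simp only [extendedMap, Fin.val_castAdd, extendedPoly, k.2, if_true]
  rfl

theorem extendedMap_natAdd (z : Fin 16 → ℝ) (k : Fin 8) :
    extendedMap z (Fin.natAdd 8 k) = (DF (xPart z) (z 8)).mulVec (vPart z) k := by
  have h : ∀ j : Fin 7, unknowns z (9 + j) = vPart z j.castSucc := by
    intro j; fin_cases j <;> rfl
  have h8 : ¬ (8 + (k : ℕ) < 8) := by omega
  simp only [extendedMap, Fin.val_natAdd, extendedPoly, h8, if_false, Nat.add_sub_cancel_left,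
    tangentPoly, polyEval_append, polyEval_polySum, polyEval_termMul, Finset.sum_range,
    monoEval_cons, monoEval_nil, h, pow_one, mul_one, Int.cast_one, one_mul]
  simp only [Matrix.mulVec, dotProduct, DF_apply _ _ (fun j => vPart z j.castSucc) 0]
  refine Eq.trans ?_ (Fin.sum_univ_castSucc _).symm
  congr 1
  · exact Finset.sum_congr rfl fun j _ => mul_comm _ _
  · exact (mul_one _).symm

theorem extendedMap_eq_zero_iff {x : Fin 8 → ℝ} {m : ℝ} {v : Fin 8 → ℝ} (hv : v 7 = 1) :
    extendedMap (assemble x m v) = 0 ↔ F x m = 0 ∧ (DF x m).mulVec v = 0 := by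
  have e8 : assemble x m v 8 = m := rfl
  have h1 := extendedMap_castAdd (assemble x m v)
  have h2 := extendedMap_natAdd (assemble x m v)
  rw [xPart_assemble, e8] at h1 h2
  rw [vPart_assemble x m hv] at h2
  constructor
  · intro h
    exact ⟨funext fun k => (h1 k).symm.trans (congrFun h _),
      funext fun k => (h2 k).symm.trans (congrFun h _)⟩
  · rintro ⟨hF, hD⟩
    funext k
    refine Fin.addCases (m := 8) (n := 8) (fun k => ?_) (fun k => ?_) k
    · rw [h1, hF]; rfl
    · rw [h2, hD]; rfl

/-- `F` does not involve `v`, and `DF(x, m) v` is linear in `v`; so the extended map is affine in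
`v`. This lets estimates valid only near the approximate zero control arbitrarily large
displacements of `v`. -/
theorem extendedMap_add_smul {x : Fin 8 → ℝ} {m : ℝ} {v u : Fin 8 → ℝ} (hv : v 7 = 1)
    (hu : u 7 = 0) (t : ℝ) :
    extendedMap (assemble x m (v + t • u)) - extendedMap (assemble x m v)
      = t • (extendedMap (assemble x m (v + u)) - extendedMap (assemble x m v)) := by
  have hvt : ∀ t : ℝ, (v + t • u) 7 = 1 := fun t => by simp [hv, hu]
  have key : ∀ t : ℝ, ∀ k, (∀ k' : Fin 8, k = Fin.castAdd 8 k' →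
      extendedMap (assemble x m (v + t • u)) k - extendedMap (assemble x m v) k = 0) ∧
      (∀ k' : Fin 8, k = Fin.natAdd 8 k' →
      extendedMap (assemble x m (v + t • u)) k - extendedMap (assemble x m v) k
        = t * (DF x m).mulVec u k') := by
    intro t k
    have e8 : ∀ v, assemble x m v 8 = m := fun _ => rfl
    constructor
    · rintro k' rfl
      rw [extendedMap_castAdd, extendedMap_castAdd, xPart_assemble, xPart_assemble, e8, e8,
        sub_self]
    · rintro k' rfl
      rw [extendedMap_natAdd, extendedMap_natAdd, xPart_assemble, xPart_assemble, e8, e8,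
        vPart_assemble x m (hvt t), vPart_assemble x m hv, Matrix.mulVec_add, Matrix.mulVec_smul]
      simp
  funext k
  have h1 := key 1
  rw [one_smul] at h1
  simp only [Pi.sub_apply, Pi.smul_apply, smul_eq_mul]
  refine Fin.addCases (m := 8) (n := 8) (fun k => ?_) (fun k => ?_) k
  · rw [(key t _).1 k rfl, (h1 _).1 k rfl, mul_zero]
  · rw [(key t _).2 k rfl, (h1 _).2 k rfl, one_mul]

/-! ### The approximate Newton operator -/

/-- The approximate zero of the extended system. -/
noncomputable def approxZero : Fin 16 → ℝ := fun i => (center.getD i 0 : ℝ) / scale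

/-- The approximate inverse of the Jacobian matrix. -/
noncomputable def approxInverseMatrix : Matrix (Fin 16) (Fin 16) ℝ :=
  fun i k => (approxInverseEntry i k : ℝ) / 10 ^ 5

/-- The Jacobian matrix of the extended system. -/
noncomputable def extendedJacobian (z : Fin 16 → ℝ) : Matrix (Fin 16) (Fin 16) ℝ :=
  fun k j => polyEval (unknowns z) (polyDeriv j (extendedPoly k))

/-- The approximate Newton operator. -/
noncomputable def newton (z : Fin 16 → ℝ) : Fin 16 → ℝ :=
  z - approxInverseMatrix.mulVec (extendedMap z)

theorem scale_pos : (0 : ℝ) < scale := by norm_num [scale]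

theorem inBall_centerBalls {z : Fin 16 → ℝ} {r : ℕ} (hz : ‖z - approxZero‖ ≤ r / scale) (i : ℕ) :
    InBall scale ((centerBalls r).getD i (0, 0)) (unknowns z i) := by
  have hlen : center.length = 16 := rfl
  by_cases hi : i < 16
  · have h1 : (centerBalls r).getD i (0, 0) = (center.getD i 0, r) := by
      rw [centerBalls, List.getD_eq_getElem _ _ (by simpa [hlen] using hi), List.getElem_map,
        List.getD_eq_getElem _ _ (by simpa [hlen] using hi)]
    have h2 := (norm_le_pi_norm (z - approxZero) ⟨i, hi⟩).trans hz
    rw [h1, show unknowns z i = z ⟨i, hi⟩ from unknowns_coord z ⟨i, hi⟩]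
    simp only [Pi.sub_apply, approxZero, Real.norm_eq_abs] at h2
    rw [InBall, ← mul_le_mul_iff_left₀ (inv_pos.2 scale_pos)]
    rw [← div_eq_mul_inv, ← div_eq_mul_inv, ← abs_of_pos scale_pos, ← abs_div, abs_of_pos scale_pos,
      sub_div, mul_div_cancel_right₀ _ scale_pos.ne']
    exact h2
  · rw [unknowns_of_le z (not_lt.1 hi), centerBalls,
      List.getD_eq_default _ _ (by simpa [hlen] using hi)]
    simp [InBall]

theorem inBall_ballSum {s : ℕ} {f : ℕ → ℤ × ℕ} {g : ℕ → ℝ} (h : ∀ k, InBall s (f k) (g k)) (n : ℕ) :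
    InBall s (ballSum f n) (∑ k ∈ Finset.range n, g k) := by
  induction n with
  | zero => simp [InBall, ballSum]
  | succ n ih => rw [Finset.sum_range_succ]; exact ih.add (h n)

theorem natSum_eq (f : ℕ → ℕ) (n : ℕ) : natSum f n = ∑ k ∈ Finset.range n, f k := by
  induction n with
  | zero => rfl
  | succ n ih => rw [natSum, ih, Finset.sum_range_succ]

theorem allBelow_iff {p : ℕ → Bool} {n : ℕ} : allBelow p n = true ↔ ∀ i < n, p i = true := by
  induction n with
  | zero => simp [allBelow]
  | succ n ih =>
    rw [allBelow, Bool.and_eq_true, ih]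
    constructor
    · rintro ⟨h1, h2⟩ i hi
      rcases Nat.lt_succ_iff_lt_or_eq.1 hi with h | rfl
      exacts [h1 i h, h2]
    · exact fun h => ⟨fun i hi => h i (hi.trans n.lt_succ_self), h n n.lt_succ_self⟩

theorem inBall_defectBall {z : Fin 16 → ℝ} {r : ℕ} (hz : ‖z - approxZero‖ ≤ r / scale)
    (i j : Fin 16) : InBall scale (defectBall r i j)
      (10 ^ 5 * (approxInverseMatrix * extendedJacobian z - 1) i j) := by
  have h1 : (10 : ℝ) ^ 5 * (approxInverseMatrix * extendedJacobian z - 1) i j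
      = ∑ k ∈ Finset.range 16, (approxInverseEntry i k : ℝ)
          * polyEval (unknowns z) (polyDeriv j (extendedPoly k))
        + (if i = j then -10 ^ 5 else 0) := by
    rw [Finset.sum_range, Matrix.sub_apply, Matrix.mul_apply, Matrix.one_apply, mul_sub,
      Finset.mul_sum, sub_eq_add_neg]
    congr 1
    · refine Finset.sum_congr rfl fun k _ => ?_
      simp only [approxInverseMatrix, extendedJacobian]
      ring
    · split_ifs <;> simp
  rw [h1, defectBall]
  refine (inBall_ballSum (fun k => (inBall_ballPoly (by simp [scale])
    (inBall_centerBalls hz) _).smul _) 16).add ?_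
  by_cases hij : i = j
  · subst hij; norm_num [InBall]
  · simp [InBall, hij, Fin.val_inj]

theorem sum_abs_defect_le {z : Fin 16 → ℝ} (hz : ‖z - approxZero‖ ≤ 10 ^ (-6 : ℤ)) (i : Fin 16) :
    ∑ j, |(approxInverseMatrix * extendedJacobian z - 1) i j| ≤ 1 / 2 := by
  have hz' : ‖z - approxZero‖ ≤ ((10 ^ 50 : ℕ) : ℝ) / scale := hz.trans (by norm_num [scale])
  have h1 : ∀ j, |(approxInverseMatrix * extendedJacobian z - 1) i j| * (10 ^ 5 * scale)
      ≤ (ballBound (defectBall (10 ^ 50) i j) : ℝ) := fun j => by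
    have := (inBall_defectBall hz' i j).abs_mul_le
    rw [abs_mul, abs_of_pos (by norm_num : (0 : ℝ) < 10 ^ 5)] at this
    linarith
  have h2 := Nat.le_of_ble_eq_true (allBelow_iff.1 defect_check i i.2)
  rw [natSum_eq, Finset.sum_range] at h2
  have h3 : (∑ j : Fin 16, (ballBound (defectBall (10 ^ 50) i j) : ℝ)) * 2 ≤ 10 ^ 5 * scale := by
    exact_mod_cast h2
  have h4 := Finset.sum_le_sum fun j (_ : j ∈ Finset.univ) => h1 j
  rw [← Finset.sum_mul] at h4
  have hp : (0 : ℝ) < 10 ^ 5 * scale := mul_pos (by norm_num) scale_pos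
  refine le_of_mul_le_mul_right ?_ hp
  linarith

theorem norm_mulVec_defect_le {z : Fin 16 → ℝ} (hz : ‖z - approxZero‖ ≤ 10 ^ (-6 : ℤ))
    (u : Fin 16 → ℝ) (i : Fin 16) :
    |(approxInverseMatrix * extendedJacobian z - 1).mulVec u i| ≤ 1 / 2 * ‖u‖ := by
  rw [Matrix.mulVec, dotProduct]
  refine (Finset.abs_sum_le_sum_abs _ _).trans ?_
  refine le_trans (Finset.sum_le_sum fun j _ => ?_)
    ((Finset.sum_mul Finset.univ _ ‖u‖).symm.trans_le
      (mul_le_mul_of_nonneg_right (sum_abs_defect_le hz i) (norm_nonneg u)))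
  rw [abs_mul]
  exact mul_le_mul_of_nonneg_left (norm_le_pi_norm u j) (abs_nonneg _)

theorem hasFDerivAt_extendedMap (z : Fin 16 → ℝ) :
    HasFDerivAt extendedMap (extendedJacobian z).mulVecLin.toContinuousLinearMap z := by
  have h : ∀ i, HasFDerivAt (fun z => unknowns z i)
      (if h : i < 16 then ContinuousLinearMap.proj (R := ℝ) (φ := fun _ : Fin 16 => ℝ) ⟨i, h⟩
        else 0) z := by
    intro i
    by_cases hi : i < 16
    · rw [dif_pos hi]
      exact (hasFDerivAt_apply (⟨i, hi⟩ : Fin 16) z).congr_of_eventuallyEq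
        (Filter.Eventually.of_forall fun z => unknowns_coord z ⟨i, hi⟩)
    · rw [dif_neg hi]
      exact (hasFDerivAt_const (0 : ℝ) z).congr_of_eventuallyEq
        (Filter.Eventually.of_forall fun z => unknowns_of_le z (not_lt.1 hi))
  refine hasFDerivAt_pi'.2 fun k => ?_
  refine (hasFDerivAt_polyEval (n := 16) h (fun i hi => dif_neg (not_lt.2 hi))
    (extendedPoly k)).congr_fderiv ?_
  rw [Finset.sum_range]
  ext u
  simp [Matrix.mulVec, dotProduct, extendedJacobian]

/-- The derivative of the Newton operator is `1 - C DH`, of norm at most `1/2` on the convex ball;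
the mean value inequality is applied to each component. -/
theorem norm_newton_sub_le {z z' : Fin 16 → ℝ} (hz : ‖z - approxZero‖ ≤ 10 ^ (-6 : ℤ))
    (hz' : ‖z' - approxZero‖ ≤ 10 ^ (-6 : ℤ)) : ‖newton z - newton z'‖ ≤ 1 / 2 * ‖z - z'‖ := by
  refine (pi_norm_le_iff_of_nonneg (by positivity)).2 fun i => ?_
  let C := approxInverseMatrix.mulVecLin.toContinuousLinearMap
  have hd : ∀ y, HasFDerivAt (fun z => newton z i)
      ((ContinuousLinearMap.proj (R := ℝ) (φ := fun _ : Fin 16 => ℝ) i).comp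
        (ContinuousLinearMap.id ℝ _
          - C.comp (extendedJacobian y).mulVecLin.toContinuousLinearMap)) y := fun y =>
    hasFDerivAt_pi'.1 ((hasFDerivAt_id y).sub (C.hasFDerivAt.comp y (hasFDerivAt_extendedMap y))) i
  have hs : ∀ y, y ∈ Metric.closedBall approxZero (10 ^ (-6 : ℤ)) ↔
      ‖y - approxZero‖ ≤ 10 ^ (-6 : ℤ) := fun y => by rw [mem_closedBall_iff_norm]
  refine (convex_closedBall approxZero (10 ^ (-6 : ℤ))).norm_image_sub_le_of_norm_hasFDerivWithin_le
    (fun y _ => (hd y).hasFDerivWithinAt) (fun y hy => ?_) ((hs z').2 hz') ((hs z).2 hz)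
  refine ContinuousLinearMap.opNorm_le_bound _ (by norm_num) fun u => ?_
  have h1 := norm_mulVec_defect_le ((hs y).1 hy) u i
  rw [Matrix.sub_mulVec, Matrix.one_mulVec, ← Matrix.mulVec_mulVec, Pi.sub_apply, abs_sub_comm]
    at h1
  exact h1

/-- If `C` were singular, so would be `C DH(z̃)`; on a null vector of the latter the defect acts as
`-1`, against its norm being at most `1/2`. -/
theorem det_approxInverseMatrix_ne_zero : approxInverseMatrix.det ≠ 0 := by
  intro h
  have h0 : (approxInverseMatrix * extendedJacobian approxZero).det = 0 := by
    rw [Matrix.det_mul, h, zero_mul]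
  obtain ⟨u, hu, hu0⟩ := Matrix.exists_mulVec_eq_zero_iff.2 h0
  have h1 : ‖u‖ ≤ 1 / 2 * ‖u‖ := by
    refine (pi_norm_le_iff_of_nonneg (by positivity)).2 fun i => ?_
    have := norm_mulVec_defect_le (z := approxZero) (by simp) u i
    rwa [Matrix.sub_mulVec, hu0, Matrix.one_mulVec, zero_sub, Pi.neg_apply, abs_neg] at this
  exact hu (norm_eq_zero.1 (by linarith [norm_nonneg u]))

theorem norm_newton_approxZero : ‖newton approxZero - approxZero‖ ≤ 10 ^ (-45 : ℤ) := by
  refine (pi_norm_le_iff_of_nonneg (by positivity)).2 fun i => ?_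
  have hz : ‖approxZero - approxZero‖ ≤ ((0 : ℕ) : ℝ) / scale := by simp
  have h1 : InBall scale (residualBall i)
      (10 ^ 5 * approxInverseMatrix.mulVec (extendedMap approxZero) i) := by
    have e : 10 ^ 5 * approxInverseMatrix.mulVec (extendedMap approxZero) i
        = ∑ k ∈ Finset.range 16, (approxInverseEntry i k : ℝ)
          * polyEval (unknowns approxZero) (extendedPoly k) := by
      rw [Finset.sum_range, Matrix.mulVec, dotProduct, Finset.mul_sum]
      refine Finset.sum_congr rfl fun k _ => ?_
      simp only [approxInverseMatrix, extendedMap]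
      ring
    rw [e]
    exact inBall_ballSum (fun k => (inBall_ballPoly (by simp [scale])
      (inBall_centerBalls hz) _).smul _) 16
  have h2 := h1.abs_mul_le
  have h3 : (ballBound (residualBall i) : ℝ) ≤ 10 ^ 16 := by
    exact_mod_cast Nat.le_of_ble_eq_true (allBelow_iff.1 residual_check i i.2)
  rw [abs_mul, abs_of_pos (by norm_num : (0 : ℝ) < 10 ^ 5)] at h2
  have e : (newton approxZero - approxZero) i
      = -approxInverseMatrix.mulVec (extendedMap approxZero) i := by simp [newton]
  rw [e, norm_neg, Real.norm_eq_abs]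
  generalize |approxInverseMatrix.mulVec (extendedMap approxZero) i| = t at h2 ⊢
  have h4 : 10 ^ 5 * t * scale ≤ 10 ^ 16 := h2.trans h3
  norm_num [scale] at h4 ⊢
  linarith

/-- From `z - z' = (N z - N z') + C (H z - H z')`: the first term is at most half the left side and
is absorbed. -/
theorem norm_sub_le_of_mem {z z' : Fin 16 → ℝ} (hz : ‖z - approxZero‖ ≤ 10 ^ (-6 : ℤ))
    (hz' : ‖z' - approxZero‖ ≤ 10 ^ (-6 : ℤ)) :
    ‖z - z'‖ ≤ 2 * ‖approxInverseMatrix.mulVec (extendedMap z - extendedMap z')‖ := by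
  have h1 := norm_newton_sub_le hz hz'
  have h2 : z - z' = (newton z - newton z')
      + approxInverseMatrix.mulVec (extendedMap z - extendedMap z') := by
    rw [Matrix.mulVec_sub, newton, newton]; abel
  have h3 := norm_add_le (newton z - newton z')
    (approxInverseMatrix.mulVec (extendedMap z - extendedMap z'))
  rw [← h2] at h3
  linarith

theorem extendedMap_injOn {z z' : Fin 16 → ℝ} (hz : ‖z - approxZero‖ ≤ 10 ^ (-6 : ℤ))
    (hz' : ‖z' - approxZero‖ ≤ 10 ^ (-6 : ℤ)) (h : extendedMap z = extendedMap z') : z = z' := by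
  have h1 := norm_sub_le_of_mem hz hz'
  rw [h, sub_self, Matrix.mulVec_zero, norm_zero, mul_zero] at h1
  exact sub_eq_zero.1 (norm_le_zero_iff.1 h1)

/-- Banach's fixed point theorem: the ball is preserved since `10⁻⁴⁴ / 2 + 10⁻⁴⁵ ≤ 10⁻⁴⁴`. A fixed
point satisfies `C H(z) = 0`, and `C` is invertible. -/
theorem exists_extendedMap_eq_zero :
    ∃ z, ‖z - approxZero‖ ≤ 10 ^ (-44 : ℤ) ∧ extendedMap z = 0 := by
  set s := Metric.closedBall approxZero (10 ^ (-44 : ℤ)) with hs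
  have hr : (10 : ℝ) ^ (-44 : ℤ) ≤ 10 ^ (-6 : ℤ) := by norm_num
  have hmem : ∀ z ∈ s, ‖z - approxZero‖ ≤ 10 ^ (-6 : ℤ) := fun z hz =>
    (mem_closedBall_iff_norm.1 hz).trans hr
  have h0 : approxZero ∈ s := Metric.mem_closedBall_self (by positivity)
  have hmaps : Set.MapsTo newton s s := by
    intro z hz
    rw [hs, mem_closedBall_iff_norm] at hz ⊢
    have h1 := norm_newton_sub_le (hmem z (mem_closedBall_iff_norm.2 hz)) (hmem _ h0)
    have h2 := norm_add_le (newton z - newton approxZero) (newton approxZero - approxZero)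
    rw [sub_add_sub_cancel] at h2
    have h3 := norm_newton_approxZero
    norm_num at h3 hz ⊢
    linarith
  have hc : ContractingWith (1 / 2) (hmaps.restrict newton s s) := by
    refine ⟨by rw [← NNReal.coe_lt_coe]; norm_num, LipschitzWith.of_dist_le_mul fun z z' => ?_⟩
    rw [Subtype.dist_eq, Subtype.dist_eq, dist_eq_norm, dist_eq_norm]
    simpa using norm_newton_sub_le (hmem z z.2) (hmem z' z'.2)
  obtain ⟨z, hz, hfix, -⟩ := hc.exists_fixedPoint' Metric.isClosed_closedBall.isComplete hmaps h0
    (edist_ne_top _ _)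
  refine ⟨z, mem_closedBall_iff_norm.1 hz, ?_⟩
  have h1 : approxInverseMatrix.mulVec (extendedMap z) = 0 := by
    have : newton z = z := hfix
    rwa [newton, sub_eq_self] at this
  by_contra hne
  exact det_approxInverseMatrix_ne_zero (Matrix.exists_mulVec_eq_zero_iff.1 ⟨_, hne, h1⟩)

/-- A null vector `u` with last coordinate 0 is a displacement of `v` that respects the
normalization and leaves the extended map unchanged, contrary to injectivity on the ball. Here `v`
need not be a null vector. -/
theorem eq_zero_of_DF_mulVec_eq_zero {x : Fin 8 → ℝ} {m : ℝ} {v u : Fin 8 → ℝ} (hv : v 7 = 1)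
    (hz : ‖assemble x m v - approxZero‖ < 10 ^ (-6 : ℤ)) (hu : (DF x m).mulVec u = 0)
    (hu7 : u 7 = 0) : u = 0 := by
  by_contra hne
  have hd : assemble 0 0 u ≠ 0 := fun h => hne (eq_zero_of_assemble_eq_zero h hu7)
  have hd' := norm_pos_iff.2 hd
  -- The step uses up exactly the remaining distance to the sphere of radius `10⁻⁶`.
  set t := (10 ^ (-6 : ℤ) - ‖assemble x m v - approxZero‖) / ‖assemble 0 0 u‖ with ht
  have htpos : 0 < t := div_pos (sub_pos.2 hz) hd'
  have h1 : ‖assemble x m (v + t • u) - approxZero‖ ≤ 10 ^ (-6 : ℤ) := by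
    rw [assemble_add_smul, add_sub_right_comm]
    refine (norm_add_le _ _).trans ?_
    rw [norm_smul, Real.norm_eq_abs, abs_of_pos htpos, ht, div_mul_cancel₀ _ hd'.ne']
    linarith
  have h2 : extendedMap (assemble x m (v + t • u)) = extendedMap (assemble x m v) := by
    have e8 : ∀ v, assemble x m v 8 = m := fun _ => rfl
    funext k
    refine Fin.addCases (m := 8) (n := 8) (fun k => ?_) (fun k => ?_) k
    · rw [extendedMap_castAdd, extendedMap_castAdd, xPart_assemble, xPart_assemble, e8, e8]
    · rw [extendedMap_natAdd, extendedMap_natAdd, xPart_assemble, xPart_assemble, e8, e8,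
        vPart_assemble x m (by simp [hv, hu7]), vPart_assemble x m hv, Matrix.mulVec_add,
        Matrix.mulVec_smul, hu, smul_zero, add_zero]
  have h3 := extendedMap_injOn h1 hz.le h2
  rw [assemble_add_smul, add_eq_left, smul_eq_zero] at h3
  exact h3.elim htpos.ne' hd

/-- A normalized null vector could a priori be far from the centre. With `y` the central vector and
`u = v - y`, affinity gives `H(x, m, y + t u) - H(x, m, y) = -t H(x, m, y)`. For small `t` both
points are in the ball, so the inverse Lipschitz bound applies; dividing it by `t` bounds `u`
itself. -/
theorem norm_assemble_sub_le {x : Fin 8 → ℝ} {m : ℝ} {v : Fin 8 → ℝ}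
    (hx : ‖assemble x m (vPart approxZero) - approxZero‖ ≤ 10 ^ (-20 : ℤ)) (hv : v 7 = 1)
    (hF : F x m = 0) (hD : (DF x m).mulVec v = 0) :
    ‖assemble x m v - approxZero‖ ≤ 10 ^ (-6 : ℤ) := by
  set y := vPart approxZero with hy
  have hy7 : y 7 = 1 := rfl
  set u := v - y with hu
  have hu7 : u 7 = 0 := by simp [hu, hv, hy7]
  have hvy : v = y + u := by simp [hu]
  have hr : ‖assemble x m y - approxZero‖ ≤ 10 ^ (-6 : ℤ) := hx.trans (by norm_num)
  have h0 : ‖approxZero - approxZero‖ ≤ (10 : ℝ) ^ (-6 : ℤ) := by simp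
  have hzero : extendedMap (assemble x m (y + u)) = 0 := by
    rw [← hvy]; exact (extendedMap_eq_zero_iff hv).2 ⟨hF, hD⟩
  -- `C H` is the identity minus the Newton operator, so its value here is at most `(1 + 1/2) 10⁻²⁰
  -- + 10⁻⁴⁵`.
  have hC : ‖approxInverseMatrix.mulVec (extendedMap (assemble x m y))‖ ≤ 10 ^ (-19 : ℤ) := by
    have e : approxInverseMatrix.mulVec (extendedMap (assemble x m y))
        = (assemble x m y - approxZero) - (newton (assemble x m y) - newton approxZero)
          - (newton approxZero - approxZero) := by
      rw [newton]; abel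
    rw [e]
    refine (norm_sub_le _ _).trans ((add_le_add_left (norm_sub_le _ _) _).trans ?_)
    have h1 := norm_newton_sub_le hr h0
    have h2 := norm_newton_approxZero
    norm_num at hx h1 h2 ⊢
    linarith
  have hd : ‖assemble 0 0 u‖ ≤ 2 * 10 ^ (-19 : ℤ) := by
    set t : ℝ := 10 ^ (-7 : ℤ) / (‖assemble 0 0 u‖ + 1) with ht
    have hp : 0 < ‖assemble 0 0 u‖ + 1 := by positivity
    have htpos : 0 < t := by positivity
    have htd : t * ‖assemble 0 0 u‖ ≤ 10 ^ (-7 : ℤ) := by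
      rw [ht, div_mul_eq_mul_div, div_le_iff₀ hp]
      exact mul_le_mul_of_nonneg_left (by linarith) (by positivity)
    have h1 : ‖assemble x m (y + t • u) - approxZero‖ ≤ 10 ^ (-6 : ℤ) := by
      rw [assemble_add_smul, add_sub_right_comm]
      refine (norm_add_le _ _).trans ?_
      rw [norm_smul, Real.norm_eq_abs, abs_of_pos htpos]
      norm_num at hx htd ⊢
      linarith
    have h2 := norm_sub_le_of_mem h1 hr
    rw [extendedMap_add_smul hy7 hu7, hzero, zero_sub, smul_neg, Matrix.mulVec_neg,
      Matrix.mulVec_smul, norm_neg, norm_smul, assemble_add_smul, add_sub_cancel_left, norm_smul,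
      Real.norm_eq_abs, abs_of_pos htpos] at h2
    have h3 : ‖assemble 0 0 u‖ ≤ 2 * ‖approxInverseMatrix.mulVec (extendedMap (assemble x m y))‖ :=
      le_of_mul_le_mul_left (by linarith) htpos
    linarith
  have h4 := assemble_add_smul x m y u 1
  rw [one_smul, one_smul, ← hvy] at h4
  rw [h4, add_sub_right_comm]
  refine (norm_add_le _ _).trans ?_
  norm_num at hx hd ⊢
  linarith

/-! ### The left null vector -/

/-- Both sides are `d_j d_k ∂_j ∂_k V`: off the diagonal, differentiating `F_k = d_k ∂_k V` in `x_j`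
does not touch `d_k`. The proof compares the polynomials entry by entry, so no distance has to be
nonzero. -/
theorem denominators_mul_DF_of_lt (x : Fin 8 → ℝ) (m : ℝ) {k j : Fin 8} (h : k < j) :
    denominators (masses m) x j * DF x m k j = denominators (masses m) x k * DF x m j k := by
  rw [DF_apply x m 0 0, DF_apply x m 0 0]
  fin_cases k <;> fin_cases j <;> first
    | exact absurd h (by decide)
    | (simp [dziobekPoly, distancePoly, termMul, cayleyMengerPoly, polyDeriv, monoDeriv, monoMul,
        monoInsert, point, denominators, totalMass, masses, Fin.sum_univ_four]
       try ring)

/-- The Jacobian matrix is symmetric up to the denominators. -/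
theorem denominators_mul_DF (x : Fin 8 → ℝ) (m : ℝ) (k j : Fin 8) :
    denominators (masses m) x j * DF x m k j = denominators (masses m) x k * DF x m j k := by
  rcases lt_trichotomy k j with h | rfl | h
  · exact denominators_mul_DF_of_lt x m h
  · rfl
  · exact (denominators_mul_DF_of_lt x m h).symm

/-- The left null vector that belongs to a right null vector `v`. -/
noncomputable def leftVector (x : Fin 8 → ℝ) (m : ℝ) (v : Fin 8 → ℝ) : Fin 8 → ℝ :=
  fun k => v k * denominators (masses m) x 7 / denominators (masses m) x k

theorem transpose_DF_mulVec_leftVector {x : Fin 8 → ℝ} {m : ℝ} {v : Fin 8 → ℝ}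
    (hd : ∀ k, denominators (masses m) x k ≠ 0) (hv : (DF x m).mulVec v = 0) :
    (DF x m).transpose.mulVec (leftVector x m v) = 0 := by
  funext j
  have h : ∀ k, (DF x m).transpose j k * leftVector x m v k
      = denominators (masses m) x 7 / denominators (masses m) x j * (DF x m j k * v k) := by
    intro k
    rw [Matrix.transpose_apply, leftVector]
    have := denominators_mul_DF x m k j
    field_simp [hd k, hd j]
    linear_combination (v k * denominators (masses m) x 7) * this
  have h2 : ∑ k, DF x m j k * v k = 0 := congrFun hv j
  rw [Matrix.mulVec, dotProduct, Finset.sum_congr rfl fun k _ => h k, ← Finset.mul_sum, h2,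
    mul_zero]
  rfl

/-! ### Enclosures of the null vectors and of the bifurcation coefficients -/

/-- The coordinates of `v` as monomials. -/
def vMono (i : ℕ) : Mono := if i < 7 then [(9 + i, 1)] else []

/-- The coordinates of `w` as monomials. -/
def wMono (i : ℕ) : Mono := if i < 7 then [(16 + i, 1)] else []

/-- The denominators as polynomials. -/
def denominatorPoly : ℕ → Poly
  | 0 => [(2, []), (2, [(8, 1)])]
  | 1 => [(1, [])]
  | k => [(2, [(k, 2)]), (2, [(8, 1), (k, 2)])]

/-- The polynomial `d₈ v_k - d_k w_k`, where `d` are the denominators. -/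
def leftPoly (k : ℕ) : Poly :=
  termMul 1 (vMono k) (denominatorPoly 7) ++ termMul (-1) (wMono k) (denominatorPoly k)

/-- The polynomial `w · F_m`. -/
def transversalityPoly : Poly :=
  polySum (fun k => termMul 1 (wMono k) (polyDeriv 8 (dziobekPoly k))) 8

/-- The polynomial `w · D²F(v, v)`. -/
def curvaturePoly : Poly :=
  polySum (fun k => termMul 1 (wMono k) (polySum (fun i => polySum (fun j =>
    termMul 1 (monoMul (vMono i) (vMono j)) (polyDeriv i (polyDeriv j (dziobekPoly k)))) 8) 8)) 8

/-- The enclosures of the unknowns and of the left null vector. -/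
def nullBalls (r t : ℕ) : List (ℤ × ℕ) := centerBalls r ++ leftCenter.map fun c => (c, t)

/-- Cross-multiplied form of the comparison of `v_k d₈ / d_k` with the approximate left vector, as
ball arithmetic has no division. The unknowns have radius `10⁻⁴⁴`, the approximate vector is exact,
and the bound is `10⁻⁴²`. -/
theorem leftPoly_check : allBelow (fun k => Nat.ble
    (ballBound (ballPoly scale (nullBalls (10 ^ 12) 0) (leftPoly k))) (10 ^ 14)) 7 = true := by
  decide +kernel

theorem transversalityPoly_check : Nat.ble (ballBound
    (ballAdd (ballPoly scale (nullBalls (10 ^ 12) (10 ^ 15)) transversalityPoly)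
      (-632247017553985546 * 10 ^ 39, 0))) (10 ^ 39) = true := by
  decide +kernel

theorem curvaturePoly_check : Nat.ble (ballBound
    (ballAdd (ballPoly scale (nullBalls (10 ^ 12) (10 ^ 15)) curvaturePoly)
      (22708976277782379 * 10 ^ 42, 0))) (10 ^ 42) = true := by
  decide +kernel

theorem inBall_nullBalls {z : Fin 16 → ℝ} {w : Fin 8 → ℝ} {r t : ℕ}
    (hz : ‖z - approxZero‖ ≤ r / scale)
    (hw : ∀ j : Fin 7, |w j.castSucc - (leftCenter.getD j 0 : ℝ) / scale| ≤ t / scale) (i : ℕ) :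
    InBall scale ((nullBalls r t).getD i (0, 0))
      (point (xPart z) (z 8) (fun j => vPart z j.castSucc) (fun j => w j.castSucc) i) := by
  have hlen : (centerBalls r).length = 16 := rfl
  have hlen' : leftCenter.length = 7 := rfl
  by_cases hi : i < 16
  · rw [nullBalls, List.getD_append _ _ _ _ (by rwa [hlen])]
    have h := inBall_centerBalls hz i
    have e : unknowns z i
        = point (xPart z) (z 8) (fun j => vPart z j.castSucc) (fun j => w j.castSucc) i := by
      interval_cases i <;> rfl
    rwa [e] at h
  · obtain ⟨j, rfl⟩ := Nat.exists_eq_add_of_le (not_lt.1 hi)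
    rw [nullBalls, List.getD_append_right _ _ _ _ (by rw [hlen]; omega), hlen,
      Nat.add_sub_cancel_left]
    by_cases hj : j < 7
    · have e : point (xPart z) (z 8) (fun j => vPart z j.castSucc) (fun j => w j.castSucc) (16 + j)
          = w (Fin.castSucc ⟨j, hj⟩) := by
        interval_cases j <;> rfl
      have h1 : (leftCenter.map fun c => (c, t)).getD j (0, 0) = (leftCenter.getD j 0, t) := by
        rw [List.getD_eq_getElem _ _ (by simpa [hlen'] using hj), List.getElem_map,
          List.getD_eq_getElem _ _ (by simpa [hlen'] using hj)]
      have h2 := mul_le_mul_of_nonneg_right (hw ⟨j, hj⟩) scale_pos.le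
      rw [div_mul_cancel₀ _ scale_pos.ne', ← abs_of_pos scale_pos, ← abs_mul, abs_of_pos scale_pos,
        sub_mul, div_mul_cancel₀ _ scale_pos.ne'] at h2
      rw [e, h1]
      exact h2
    · rw [List.getD_eq_default _ _ (by simpa [hlen'] using hj)]
      obtain ⟨k, rfl⟩ := Nat.exists_eq_add_of_le' (not_lt.1 hj)
      have e : point (xPart z) (z 8) (fun j => vPart z j.castSucc) (fun j => w j.castSucc)
          (16 + (k + 7)) = 0 := by
        rw [show 16 + (k + 7) = k + 23 by ring]; rfl
      rw [e]
      simp [InBall]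

section Evaluation

variable (x : Fin 8 → ℝ) (m : ℝ) {v w : Fin 8 → ℝ}

theorem monoEval_vMono (w' : Fin 7 → ℝ) (hv : v 7 = 1) (i : Fin 8) :
    monoEval (point x m (fun j => v j.castSucc) w') (vMono i) = v i := by
  fin_cases i <;> simp [vMono, point, hv]

theorem monoEval_wMono (v' : Fin 7 → ℝ) (hw : w 7 = 1) (i : Fin 8) :
    monoEval (point x m v' (fun j => w j.castSucc)) (wMono i) = w i := by
  fin_cases i <;> simp [wMono, point, hw]

theorem polyEval_denominatorPoly (v' w' : Fin 7 → ℝ) (k : Fin 8) :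
    polyEval (point x m v' w') (denominatorPoly k) = denominators (masses m) x k := by
  fin_cases k <;>
    simp [denominatorPoly, point, denominators, totalMass, masses, Fin.sum_univ_four] <;> ring

theorem polyEval_leftPoly (hv : v 7 = 1) (hw : w 7 = 1) (k : Fin 8) :
    polyEval (point x m (fun j => v j.castSucc) (fun j => w j.castSucc)) (leftPoly k)
      = v k * denominators (masses m) x 7 - w k * denominators (masses m) x k := by
  have h7 : polyEval (point x m (fun j => v j.castSucc) fun j => w j.castSucc) (denominatorPoly 7)
      = denominators (masses m) x 7 := polyEval_denominatorPoly x m _ _ 7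
  rw [leftPoly, polyEval_append, polyEval_termMul, polyEval_termMul, monoEval_vMono x m _ hv,
    monoEval_wMono x m _ hw, polyEval_denominatorPoly x m _ _ k, h7]
  push_cast
  ring

theorem polyEval_transversalityPoly (v' : Fin 7 → ℝ) (hw : w 7 = 1) :
    polyEval (point x m v' (fun j => w j.castSucc)) transversalityPoly = w ⬝ᵥ Fm x m := by
  rw [transversalityPoly, polyEval_polySum, Finset.sum_range, dotProduct]
  refine Finset.sum_congr rfl fun k _ => ?_
  rw [polyEval_termMul, monoEval_wMono x m _ hw, Fm_apply x m v' fun j => w j.castSucc]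
  simp

theorem polyEval_curvaturePoly (hv : v 7 = 1) (hw : w 7 = 1) :
    polyEval (point x m (fun j => v j.castSucc) (fun j => w j.castSucc)) curvaturePoly
      = w ⬝ᵥ D2F x m v v := by
  have h1 := monoEval_vMono x m (fun j => w j.castSucc) hv
  have h2 := monoEval_wMono x m (fun j => v j.castSucc) hw
  have h3 := D2F_apply x m (fun j => v j.castSucc) (fun j => w j.castSucc) v v
  generalize point x m (fun j => v j.castSucc) (fun j => w j.castSucc) = ρ at h1 h2 h3 ⊢
  simp only [curvaturePoly, polyEval_polySum, Finset.sum_range, polyEval_termMul, monoEval_mul, h1,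
    h2, h3, dotProduct, Int.cast_one, one_mul]
  refine Finset.sum_congr rfl fun k _ => congrArg _ (Finset.sum_congr rfl fun i _ =>
    Finset.sum_congr rfl fun j _ => ?_)
  ring

end Evaluation

theorem abs_sub_le_of_center {z : Fin 16 → ℝ} (hz : ‖z - approxZero‖ ≤ 10 ^ (-44 : ℤ)) (i : Fin 16)
    {c ε : ℝ} (h : |(center.getD i 0 : ℝ) / 10 ^ 56 - c| + 10 ^ (-44 : ℤ) ≤ ε) : |z i - c| ≤ ε := by
  have h1 : |z i - (center.getD i 0 : ℝ) / 10 ^ 56| ≤ 10 ^ (-44 : ℤ) := by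
    have := (norm_le_pi_norm (z - approxZero) i).trans hz
    rw [Pi.sub_apply, approxZero, scale, Real.norm_eq_abs] at this
    exact_mod_cast this
  linarith [abs_sub_le (z i) ((center.getD i 0 : ℝ) / 10 ^ 56) c]

theorem xPart_mem_xBox {z : Fin 16 → ℝ} (hz : ‖z - approxZero‖ ≤ 10 ^ (-44 : ℤ)) :
    xPart z ∈ xBox :=
  ⟨abs_sub_le_of_center hz 0 (by norm_num [center, abs_le]),
    abs_sub_le_of_center hz 1 (by norm_num [center, abs_le]),
    abs_sub_le_of_center hz 2 (by norm_num [center, abs_le]),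
    abs_sub_le_of_center hz 3 (by norm_num [center, abs_le]),
    abs_sub_le_of_center hz 4 (by norm_num [center, abs_le]),
    abs_sub_le_of_center hz 5 (by norm_num [center, abs_le]),
    abs_sub_le_of_center hz 6 (by norm_num [center, abs_le]),
    abs_sub_le_of_center hz 7 (by norm_num [center, abs_le])⟩

theorem mass_mem_mBox {z : Fin 16 → ℝ} (hz : ‖z - approxZero‖ ≤ 10 ^ (-44 : ℤ)) : z 8 ∈ mBox :=
  abs_sub_le_of_center hz 8 (by norm_num [center, abs_le])

theorem vPart_mem_vBox {z : Fin 16 → ℝ} (hz : ‖z - approxZero‖ ≤ 10 ^ (-44 : ℤ)) :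
    vPart z ∈ vBox := by
  refine ⟨?_, ?_, ?_, ?_, ?_, ?_, ?_, rfl⟩
  · rw [← sub_zero (vPart z 0)]
    exact abs_sub_le_of_center hz 9 (by norm_num [center, abs_le])
  · rw [← sub_neg_eq_add]
    exact abs_sub_le_of_center hz 10 (by norm_num [center, abs_le])
  · exact abs_sub_le_of_center hz 11 (by norm_num [center, abs_le])
  · rw [← sub_neg_eq_add]
    exact abs_sub_le_of_center hz 12 (by norm_num [center, abs_le])
  · rw [← sub_neg_eq_add]
    exact abs_sub_le_of_center hz 13 (by norm_num [center, abs_le])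
  · rw [← sub_neg_eq_add]
    exact abs_sub_le_of_center hz 14 (by norm_num [center, abs_le])
  · rw [← sub_neg_eq_add]
    exact abs_sub_le_of_center hz 15 (by norm_num [center, abs_le])

theorem denominators_ge {x : Fin 8 → ℝ} {m : ℝ} (hx : x ∈ xBox) (hm : m ∈ mBox) (k : Fin 8) :
    1 / 2 ≤ denominators (masses m) x k := by
  obtain ⟨-, -, h2, h3, h4, h5, h6, h7⟩ := hx
  rw [mBox, Set.mem_ofPred_eq] at hm
  have hM : totalMass (masses m) = 2 + 2 * m := by
    simp [totalMass, masses, Fin.sum_univ_four]; ring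
  have hM' : 2 ≤ 2 + 2 * m := by
    norm_num [abs_le] at hm ⊢
    linarith [hm.1]
  -- Total mass at least 2 and distances at least `1/2` suffice.
  have hr : ∀ r : ℝ, 1 / 2 ≤ r → 1 / 2 ≤ (2 + 2 * m) * r ^ 2 := fun r hr => by nlinarith
  norm_num [abs_le] at h2 h3 h4 h5 h6 h7
  simp only [denominators, hM]
  fin_cases k
  · simp; linarith
  · norm_num
  · exact hr _ (by linarith [h2.1])
  · exact hr _ (by linarith [h3.1])
  · exact hr _ (by linarith [h4.1])
  · exact hr _ (by linarith [h5.1])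
  · exact hr _ (by linarith [h6.1])
  · exact hr _ (by linarith [h7.1])

/-- The approximate left null vector. -/
noncomputable def approxLeft : Fin 8 → ℝ :=
  Fin.snoc (fun j : Fin 7 => (leftCenter.getD j 0 : ℝ) / scale) 1

/-- The bound `10⁻⁴²` of `leftPoly_check` is divided by a denominator that is at least `1/2`, which
stays below `10⁻⁴¹`. -/
theorem abs_leftVector_sub_le {z : Fin 16 → ℝ} (hz : ‖z - approxZero‖ ≤ 10 ^ (-44 : ℤ))
    (j : Fin 7) : |leftVector (xPart z) (z 8) (vPart z) j.castSucc
      - (leftCenter.getD j 0 : ℝ) / scale| ≤ ((10 ^ 15 : ℕ) : ℝ) / scale := by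
  have hz' : ‖z - approxZero‖ ≤ ((10 ^ 12 : ℕ) : ℝ) / scale := hz.trans (by norm_num [scale])
  have hd := denominators_ge (xPart_mem_xBox hz) (mass_mem_mBox hz) j.castSucc
  have hs : approxLeft j.castSucc = (leftCenter.getD j 0 : ℝ) / scale := by simp [approxLeft]
  have hb := inBall_ballPoly (by simp [scale]) (inBall_nullBalls (w := approxLeft) (t := 0) hz'
    fun j => by simp [approxLeft]) (leftPoly j.castSucc)
  have h1 := hb.abs_mul_le
  have h2 : (ballBound (ballPoly scale (nullBalls (10 ^ 12) 0) (leftPoly j.castSucc)) : ℝ)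
      ≤ 10 ^ 14 := by
    exact_mod_cast Nat.le_of_ble_eq_true (allBelow_iff.1 leftPoly_check j j.2)
  rw [polyEval_leftPoly _ _ rfl (by simp [approxLeft]; rfl), hs] at h1
  have h3 := h1.trans h2
  have hd0 : 0 < denominators (masses (z 8)) (xPart z) j.castSucc := by linarith
  rw [leftVector, div_sub' hd0.ne', abs_div, abs_of_pos hd0, div_le_div_iff₀ hd0 scale_pos,
    mul_comm (denominators _ _ _)]
  push_cast
  linarith

theorem leftVector_seven {z : Fin 16 → ℝ} (hz : ‖z - approxZero‖ ≤ 10 ^ (-44 : ℤ)) :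
    leftVector (xPart z) (z 8) (vPart z) 7 = 1 := by
  have hd := denominators_ge (xPart_mem_xBox hz) (mass_mem_mBox hz) 7
  have h7 : vPart z 7 = 1 := rfl
  rw [leftVector, h7, one_mul, div_self (by linarith)]

theorem leftVector_mem_wBox {z : Fin 16 → ℝ} (hz : ‖z - approxZero‖ ≤ 10 ^ (-44 : ℤ)) :
    leftVector (xPart z) (z 8) (vPart z) ∈ wBox := by
  have h : ∀ (j : Fin 7) {c ε : ℝ},
      |(leftCenter.getD j 0 : ℝ) / 10 ^ 56 - c| + 10 ^ (-41 : ℤ) ≤ ε →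
      |leftVector (xPart z) (z 8) (vPart z) j.castSucc - c| ≤ ε := by
    intro j c ε h
    have h1 := abs_leftVector_sub_le hz j
    have h2 : ((10 ^ 15 : ℕ) : ℝ) / scale = 10 ^ (-41 : ℤ) := by norm_num [scale]
    have h3 : (scale : ℝ) = 10 ^ 56 := by norm_num [scale]
    rw [h2, h3] at h1
    linarith [abs_sub_le (leftVector (xPart z) (z 8) (vPart z) j.castSucc)
      ((leftCenter.getD j 0 : ℝ) / 10 ^ 56) c]
  refine ⟨?_, ?_, ?_, ?_, ?_, ?_, ?_, leftVector_seven hz⟩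
  · rw [← sub_zero (leftVector _ _ _ 0)]
    exact h 0 (by norm_num [leftCenter, abs_le])
  · rw [← sub_neg_eq_add]
    exact h 1 (by norm_num [leftCenter, abs_le])
  · exact h 2 (by norm_num [leftCenter, abs_le])
  · rw [← sub_neg_eq_add]
    exact h 3 (by norm_num [leftCenter, abs_le])
  · rw [← sub_neg_eq_add]
    exact h 4 (by norm_num [leftCenter, abs_le])
  · rw [← sub_neg_eq_add]
    exact h 5 (by norm_num [leftCenter, abs_le])
  · rw [← sub_neg_eq_add]
    exact h 6 (by norm_num [leftCenter, abs_le])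

theorem transversality_enclosure {z : Fin 16 → ℝ} (hz : ‖z - approxZero‖ ≤ 10 ^ (-44 : ℤ)) :
    |leftVector (xPart z) (z 8) (vPart z) ⬝ᵥ Fm (xPart z) (z 8) - 6.32247017553985546|
      ≤ 10 ^ (-17 : ℤ) := by
  have hz' : ‖z - approxZero‖ ≤ ((10 ^ 12 : ℕ) : ℝ) / scale := hz.trans (by norm_num [scale])
  have hb := inBall_ballPoly (by simp [scale]) (inBall_nullBalls hz' (abs_leftVector_sub_le hz))
    transversalityPoly
  rw [polyEval_transversalityPoly _ _ _ (leftVector_seven hz)] at hb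
  have hc : InBall scale (-632247017553985546 * 10 ^ 39, 0) (-6.32247017553985546) := by
    norm_num [InBall, scale]
  have h1 := (hb.add hc).abs_mul_le.trans
    (Nat.cast_le.2 (Nat.le_of_ble_eq_true transversalityPoly_check))
  rw [← sub_eq_add_neg] at h1
  generalize |_ - (6.32247017553985546 : ℝ)| = t at h1 ⊢
  norm_num [scale] at h1 ⊢
  linarith

theorem curvature_enclosure {z : Fin 16 → ℝ} (hz : ‖z - approxZero‖ ≤ 10 ^ (-44 : ℤ)) :
    |leftVector (xPart z) (z 8) (vPart z) ⬝ᵥ D2F (xPart z) (z 8) (vPart z) (vPart z)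
      + 227.08976277782379| ≤ 10 ^ (-14 : ℤ) := by
  have hz' : ‖z - approxZero‖ ≤ ((10 ^ 12 : ℕ) : ℝ) / scale := hz.trans (by norm_num [scale])
  have hb := inBall_ballPoly (by simp [scale]) (inBall_nullBalls hz' (abs_leftVector_sub_le hz))
    curvaturePoly
  rw [polyEval_curvaturePoly _ _ rfl (leftVector_seven hz)] at hb
  have hc : InBall scale (22708976277782379 * 10 ^ 42, 0) 227.08976277782379 := by
    norm_num [InBall, scale]
  have h1 := (hb.add hc).abs_mul_le.trans
    (Nat.cast_le.2 (Nat.le_of_ble_eq_true curvaturePoly_check))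
  generalize |_ + (227.08976277782379 : ℝ)| = t at h1 ⊢
  norm_num [scale] at h1 ⊢
  linarith

/-! ### Uniqueness of the bifurcation point -/

/-- Places the whole box deep inside the ball of radius `10⁻⁶`, with the `v`-coordinates put exactly
at the centre. -/
theorem norm_assemble_approx_le {x : Fin 8 → ℝ} {m : ℝ} (hx : x ∈ xBox) (hm : m ∈ mBox) :
    ‖assemble x m (vPart approxZero) - approxZero‖ ≤ 10 ^ (-20 : ℤ) := by
  obtain ⟨h0, h1, h2, h3, h4, h5, h6, h7⟩ := hx
  rw [mBox, Set.mem_ofPred_eq] at hm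
  have key : ∀ (i : Fin 16) {y c ε : ℝ}, |y - c| ≤ ε →
      |c - (center.getD i 0 : ℝ) / 10 ^ 56| + ε ≤ 10 ^ (-20 : ℤ) →
      |y - approxZero i| ≤ 10 ^ (-20 : ℤ) := by
    intro i y c ε h h'
    have h3 : (scale : ℝ) = 10 ^ 56 := by norm_num [scale]
    rw [approxZero, h3]
    linarith [abs_sub_le y c ((center.getD i 0 : ℝ) / 10 ^ 56)]
  refine (pi_norm_le_iff_of_nonneg (by positivity)).2 fun i => ?_
  rw [Pi.sub_apply, Real.norm_eq_abs]
  by_cases hi : 9 ≤ i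
  · have : assemble x m (vPart approxZero) i = approxZero i := by
      fin_cases i <;> first | exact absurd hi (by decide) | rfl
    rw [this, sub_self, abs_zero]
    positivity
  · fin_cases i
    · exact key 0 h0 (by norm_num [center, abs_le])
    · exact key 1 h1 (by norm_num [center, abs_le])
    · exact key 2 h2 (by norm_num [center, abs_le])
    · exact key 3 h3 (by norm_num [center, abs_le])
    · exact key 4 h4 (by norm_num [center, abs_le])
    · exact key 5 h5 (by norm_num [center, abs_le])
    · exact key 6 h6 (by norm_num [center, abs_le])
    · exact key 7 h7 (by norm_num [center, abs_le])
    · exact key 8 hm (by norm_num [center, abs_le])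
    all_goals exact absurd (by decide) hi

/-- A singular solution in the box, with its normalized null vector, is the zero of the extended
system. -/
theorem eq_of_mem_box {z : Fin 16 → ℝ} (hz : ‖z - approxZero‖ ≤ 10 ^ (-44 : ℤ))
    (hz0 : extendedMap z = 0) {x : Fin 8 → ℝ} {m : ℝ} (hx : x ∈ xBox) (hm : m ∈ mBox)
    (hF : F x m = 0) (hdet : (DF x m).det = 0) : x = xPart z ∧ m = z 8 := by
  have hbox := norm_assemble_approx_le hx hm
  obtain ⟨u, hu, hu0⟩ := Matrix.exists_mulVec_eq_zero_iff.2 hdet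
  -- The null vector can thus be scaled to last coordinate 1, which makes it an unknown of the
  -- extended system.
  have hu7 : u 7 ≠ 0 := fun h => hu (eq_zero_of_DF_mulVec_eq_zero (v := vPart approxZero) rfl
    (hbox.trans_lt (by norm_num)) hu0 h)
  have hy7 : ((u 7)⁻¹ • u) 7 = 1 := by simp [hu7]
  have hy0 : (DF x m).mulVec ((u 7)⁻¹ • u) = 0 := by rw [Matrix.mulVec_smul, hu0, smul_zero]
  have h1 := norm_assemble_sub_le hbox hy7 hF hy0
  have h2 := extendedMap_injOn h1 (hz.trans (by norm_num))
    (((extendedMap_eq_zero_iff hy7).2 ⟨hF, hy0⟩).trans hz0.symm)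
  rw [← h2, xPart_assemble]
  exact ⟨rfl, rfl⟩

end FourBody

/-! ### The main theorem -/

open FourBody in
theorem mainTheorem4 :
    ∃ (x : Fin 8 → ℝ) (m : ℝ), x ∈ FourBody.xBox ∧ m ∈ FourBody.mBox ∧
      FourBody.F x m = 0 ∧ (FourBody.DF x m).det = 0 ∧
      (∀ x' ∈ FourBody.xBox, ∀ m' ∈ FourBody.mBox, FourBody.F x' m' = 0 → (FourBody.DF x' m').det = 0 → x' = x ∧ m' = m) ∧
      Module.finrank ℝ (LinearMap.ker (FourBody.DF x m).mulVecLin) = 1 ∧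
      (∃ v ∈ FourBody.vBox, ∃ w ∈ FourBody.wBox,
        (FourBody.DF x m).mulVec v = 0 ∧ (FourBody.DF x m).transpose.mulVec w = 0 ∧
        |w ⬝ᵥ FourBody.Fm x m - 6.32247017553985546| ≤ 10 ^ (-17 : ℤ) ∧
        |w ⬝ᵥ FourBody.D2F x m v v + 227.08976277782379| ≤ 10 ^ (-14 : ℤ)) ∧
      IsFoldBifurcation FourBody.F x m := by
  obtain ⟨z, hz, hz0⟩ := exists_extendedMap_eq_zero
  have hv7 : vPart z 7 = 1 := rfl
  have hx := xPart_mem_xBox hz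
  have hm := mass_mem_mBox hz
  have hzero := hz0
  rw [← assemble_parts z, extendedMap_eq_zero_iff hv7] at hzero
  obtain ⟨hF, hD⟩ := hzero
  have hv0 : vPart z ≠ 0 := fun h => by simp [h] at hv7
  -- The difference of the two sides is a null vector with last coordinate 0.
  have hker : ∀ u, (DF (xPart z) (z 8)).mulVec u = 0 → u = u 7 • vPart z := by
    intro u hu
    have hz' : ‖assemble (xPart z) (z 8) (vPart z) - approxZero‖ < 10 ^ (-6 : ℤ) := by
      rw [assemble_parts]; exact hz.trans_lt (by norm_num)
    refine sub_eq_zero.1 (eq_zero_of_DF_mulVec_eq_zero hv7 hz' ?_ ?_)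
    · rw [Matrix.mulVec_sub, Matrix.mulVec_smul, hu, hD, smul_zero, sub_zero]
    · simp [hv7]
  have hd : ∀ k, denominators (masses (z 8)) (xPart z) k ≠ 0 := fun k => by
    have := denominators_ge hx hm k
    linarith
  have hw := transpose_DF_mulVec_leftVector hd hD
  have hT := transversality_enclosure hz
  have hK := curvature_enclosure hz
  have hT' : 0 < leftVector (xPart z) (z 8) (vPart z) ⬝ᵥ Fm (xPart z) (z 8) := by
    have := (abs_le.1 hT).1
    norm_num at this
    linarith
  have hK' : leftVector (xPart z) (z 8) (vPart z)
      ⬝ᵥ D2F (xPart z) (z 8) (vPart z) (vPart z) < 0 := by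
    have := (abs_le.1 hK).2
    norm_num at this
    linarith
  refine ⟨xPart z, z 8, hx, hm, hF, Matrix.exists_mulVec_eq_zero_iff.1 ⟨_, hv0, hD⟩,
    fun x' hx' m' hm' hF' hdet => eq_of_mem_box hz hz0 hx' hm' hF' hdet, ?_,
    ⟨_, vPart_mem_vBox hz, _, leftVector_mem_wBox hz, hD, hw, hT, hK⟩, ?_⟩
  · refine finrank_eq_one_iff'.2 ⟨⟨vPart z, hD⟩, fun h => hv0 (congrArg Subtype.val h), ?_⟩
    rintro ⟨u, hu⟩
    exact ⟨u 7, Subtype.ext (hker u hu).symm⟩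
  · refine isFoldBifurcation_of_nondegenerate contDiff_F hF 7 hv7
      (fun u hu => ⟨u 7, hker u (by rw [DF_mulVec, hu])⟩)
      (w := leftVector (xPart z) (z 8) (vPart z)) (fun u => ?_) hT' hK'
    rw [← DF_mulVec, Matrix.dotProduct_mulVec, ← Matrix.mulVec_transpose, hw, zero_dotProduct]
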